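/- Let $X$ be a proper, geodesically complete $CAT(-1)$ space, let $T^1X$ be its unit tangent bundle (germs at time $0$ of geodesic lines $\mathbb{R}\to X$) with footpoint projection $\pi:T^1X\to X$, and let $\Gamma$ be a countable group acting on $X$ by isometries, nonelementary in the sense that it contains two loxodromic isometries without a common fixed point in $\partial X$. Let $F:T^1X\to\mathbb{R}$ be a potential, i.e. a $\Gamma$-invariant function whose restriction to every geodesic line is locally integrable (for instance a continuous $\Gamma$-invariant function), and put $$d_F(x,y):=\int_x^y F\,dt ,$$ the integral being taken along the geodesic from $x$ to $y$. Assume that $F$ has the Hölder-control property: (a) there are $c_1>0$ and $c_2\in(0,1)$ such that for all $x,y,x',y'\in X$ with $d(x,x')\le 1$ and $d(y,y')\le 1$, $$|d_F(x',y')-d_F(x,y)|\le \Big(c_1+\sup_{\pi^{-1}(B(x,d(x,x')))}|F|\Big)d(x,x')^{c_2}+\Big(c_1+\sup_{\pi^{-1}(B(y,d(y,y')))}|F|\Big)d(y,y')^{c_2},$$ where $B(x,r)$ denotes the closed ball; (b) for each $a>1$ there is $b>0$ such that $|F(v)-F(w)|\le b\,a^{d(\pi(v),\pi(w))}$ for all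 $v,w\in T^1X$. Let $o\in X$, and let $\mu$ be a probability measure on $\Gamma$ whose support generates $\Gamma$ as a semigroup and which has finite exponential moment, i.e. $\sum_{g\in\Gamma}e^{t\,d(o,go)}\mu(g)<\infty$ for some $t>0$. Let $\omega_n=g_1g_2\cdots g_n$, where $g_1,g_2,\dots$ are independent with distribution $\mu$. Then there is a real number $\ell_{F,\mu}$ such that, for almost every sample path $\omega$, $$\lim_{n\to\infty}\frac{d_F(o,\omega_n o)}{n}=\ell_{F,\mu}.$$ -/

import Mathlib

open MeasureTheory Filter Topology

noncomputable section

/-- `X` is a geodesic space: any two points are joined by an isometrically embedded interval. -/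
def IsGeodesicSpace (X : Type*) [MetricSpace X] : Prop :=
  ∀ x y : X, ∃ γ : ℝ → X, γ 0 = x ∧ γ (dist x y) = y ∧
    ∀ s ∈ Set.Icc 0 (dist x y), ∀ t ∈ Set.Icc 0 (dist x y), dist (γ s) (γ t) = |s - t|

/-- `X` is a `CAT(-1)` space: it is geodesic, and geodesic triangles are not thicker than their
comparison triangles in the hyperbolic plane (Mathlib's `UpperHalfPlane`, of curvature `-1`).
In a geodesic space, the points `x` with `dist p x + dist x q = dist p q` are the points that lie
on a geodesic segment from `p` to `q`, so `p, q, r` are the vertices of a geodesic triangle and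
`x`, `y` are points on its sides `[p, q]`, `[p, r]` (every pair of sides is of this form after
relabelling the vertices, and two points on the same side satisfy the comparison trivially).
The comparison triangle `p', q', r'` exists and is unique up to an isometry of the hyperbolic
plane, and the comparison points `x'`, `y'` exist and are unique, so that asking the
inequality for one choice or for every choice of them is the same. -/
structure IsCATNegOne (X : Type*) [MetricSpace X] : Prop where
  geodesic : IsGeodesicSpace X
  comparison : ∀ p q r : X, ∃ p' q' r' : UpperHalfPlane,
    dist p' q' = dist p q ∧ dist p' r' = dist p r ∧ dist q' r' = dist q r ∧
    ∀ x y : X, dist p x + dist x q = dist p q → dist p y + dist y r = dist p r →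
      ∃ x' y' : UpperHalfPlane,
        dist p' x' = dist p x ∧ dist x' q' = dist x q ∧
        dist p' y' = dist p y ∧ dist y' r' = dist y r ∧ dist x y ≤ dist x' y'

/-- Geodesic lines: isometric embeddings of the real line. -/
structure GeodesicLine (X : Type*) [MetricSpace X] where
  toFun : ℝ → X
  isometry : Isometry toFun

namespace GeodesicLine

variable {X : Type*} [MetricSpace X]

/-- The geodesic flow: `(ℓ.flow s)(t) = ℓ(s + t)`. -/
def flow (s : ℝ) (ℓ : GeodesicLine X) : GeodesicLine X where
  toFun t := ℓ.toFun (s + t)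
  isometry := ℓ.isometry.comp (isometry_add_left s)

/-- The line with the opposite orientation. -/
def reverse (ℓ : GeodesicLine X) : GeodesicLine X where
  toFun t := ℓ.toFun (-t)
  isometry := ℓ.isometry.comp (IsometryEquiv.neg ℝ).isometry

/-- The image of a line under an isometry of `X` given by a group element. -/
def translate {Γ : Type*} [Group Γ] [MulAction Γ X] [IsIsometricSMul Γ X]
    (g : Γ) (ℓ : GeodesicLine X) : GeodesicLine X where
  toFun t := g • ℓ.toFun t
  isometry := (isometry_smul X g).comp ℓ.isometry

/-- Two lines have the same germ at time `0`. -/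
instance germSetoid (X : Type*) [MetricSpace X] : Setoid (GeodesicLine X) where
  r ℓ m := ℓ.toFun =ᶠ[𝓝 0] m.toFun
  iseqv := ⟨fun _ => EventuallyEq.rfl, fun h => h.symm, fun h h' => h.trans h'⟩

/-- Two lines have the same endpoint at `+∞` in the boundary at infinity of `X`. -/
def SameForwardEndpoint (ℓ m : GeodesicLine X) : Prop :=
  ∃ C : ℝ, ∀ t : ℝ, 0 ≤ t → dist (ℓ.toFun t) (m.toFun t) ≤ C

end GeodesicLine

/-- `X` is geodesically complete: every nonconstant geodesic segment extends to a line. (In a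
`CAT(-1)` space there is only one geodesic segment from `x` to `y`.) -/
def IsGeodesicallyComplete (X : Type*) [MetricSpace X] : Prop :=
  ∀ x y : X, x ≠ y → ∃ ℓ : GeodesicLine X, ℓ.toFun 0 = x ∧ ℓ.toFun (dist x y) = y

/-- The unit tangent bundle `T¹X`: germs at time `0` of geodesic lines. -/
def UnitTangent (X : Type*) [MetricSpace X] : Type _ :=
  Quotient (GeodesicLine.germSetoid X)

/-- The tangent vector of the line `ℓ` at time `t`. -/
def GeodesicLine.tangent {X : Type*} [MetricSpace X] (ℓ : GeodesicLine X) (t : ℝ) :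
    UnitTangent X :=
  Quotient.mk (GeodesicLine.germSetoid X) (ℓ.flow t)

/-- The footpoint projection `π : T¹X → X`. -/
def UnitTangent.foot {X : Type*} [MetricSpace X] (v : UnitTangent X) : X :=
  Quotient.lift (fun ℓ : GeodesicLine X => ℓ.toFun 0)
    (fun _ _ (h : _ =ᶠ[𝓝 (0 : ℝ)] _) => h.eq_of_nhds) v

open Classical in
/-- The F-ake distance `d_F(x, y) = ∫_x^y F dt`: the integral of `F` over the tangent vectors of
the oriented geodesic segment from `x` to `y`, written with a line that extends this segment. The
choice of the line does not matter, see `fakeDist_eq_integral`. -/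
def fakeDist {X : Type*} [MetricSpace X] (F : UnitTangent X → ℝ) (x y : X) : ℝ :=
  if h : ∃ ℓ : GeodesicLine X, ℓ.toFun 0 = x ∧ ℓ.toFun (dist x y) = y then
    ∫ t in (0 : ℝ)..dist x y, F (h.choose.tangent t)
  else 0

/-- `max |F|` over the tangent vectors with footpoint in the closed ball `B(x, r)`. -/
def maxAbsOnBall {X : Type*} [MetricSpace X] (F : UnitTangent X → ℝ) (x : X) (r : ℝ) : ℝ :=
  sSup ((fun v => |F v|) '' {v : UnitTangent X | v.foot ∈ Metric.closedBall x r})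

/-- The Hölder-control property (HC) of a potential. -/
structure HasHolderControl {X : Type*} [MetricSpace X] (F : UnitTangent X → ℝ) : Prop where
  holder : ∃ c₁ > 0, ∃ c₂ ∈ Set.Ioo (0 : ℝ) 1, ∀ x y x' y' : X,
    dist x x' ≤ 1 → dist y y' ≤ 1 →
      |fakeDist F x' y' - fakeDist F x y| ≤
        (c₁ + maxAbsOnBall F x (dist x x')) * dist x x' ^ c₂ +
        (c₁ + maxAbsOnBall F y (dist y y')) * dist y y' ^ c₂
  subexponential : ∀ a : ℝ, 1 < a → ∃ b : ℝ, 0 < b ∧ ∀ v w : UnitTangent X,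
    |F v - F w| ≤ b * a ^ dist v.foot w.foot

/-- A potential: a `Γ`-invariant function on `T¹X` that can be integrated along geodesics (for
instance a continuous one). -/
structure IsPotential (Γ : Type*) {X : Type*} [MetricSpace X] [Group Γ] [MulAction Γ X]
    [IsIsometricSMul Γ X] (F : UnitTangent X → ℝ) : Prop where
  invariant : ∀ (g : Γ) (ℓ : GeodesicLine X) (t : ℝ),
    F ((ℓ.translate g).tangent t) = F (ℓ.tangent t)
  locallyIntegrable : ∀ ℓ : GeodesicLine X, LocallyIntegrable (fun t => F (ℓ.tangent t)) volume

/-- `g` is a loxodromic isometry with axis `ℓ`, translating it in the positive direction. -/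
def IsLoxodromicWithAxis {Γ X : Type*} [MetricSpace X] [Group Γ] [MulAction Γ X]
    (g : Γ) (ℓ : GeodesicLine X) : Prop :=
  ∃ τ : ℝ, 0 < τ ∧ ∀ t : ℝ, g • ℓ.toFun t = ℓ.toFun (t + τ)

/-- The action is nonelementary: the group contains two loxodromic isometries without a common
fixed point at infinity. -/
def IsNonelementaryAction (Γ X : Type*) [MetricSpace X] [Group Γ] [MulAction Γ X] : Prop :=
  ∃ (g h : Γ) (ℓ m : GeodesicLine X),
    IsLoxodromicWithAxis g ℓ ∧ IsLoxodromicWithAxis h m ∧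
    ¬ ℓ.SameForwardEndpoint m ∧ ¬ ℓ.SameForwardEndpoint m.reverse ∧
    ¬ ℓ.reverse.SameForwardEndpoint m ∧ ¬ ℓ.reverse.SameForwardEndpoint m.reverse

/-- The support of `μ` generates `Γ` as a semigroup. -/
def IsGenerating {Γ : Type*} [Group Γ] [MeasurableSpace Γ] (μ : Measure Γ) : Prop :=
  Subsemigroup.closure {g : Γ | μ {g} ≠ 0} = ⊤

/-- `μ` has finite exponential moment: `∑ g, exp (t d(o, g o)) μ(g) < ∞` for some `t > 0`. -/
def HasExponentialMoment {Γ X : Type*} [MetricSpace X] [Group Γ] [MulAction Γ X]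
    [MeasurableSpace Γ] (μ : Measure Γ) (o : X) : Prop :=
  ∃ t : ℝ, 0 < t ∧ Integrable (fun g : Γ => Real.exp (t * dist o (g • o))) μ

/-- The random walk `ω_n = g_1 ⋯ g_n` with increments `g_{i+1} = g i`, started at `ω_0 = 1`. -/
def walk {Γ : Type*} [Group Γ] (g : ℕ → Γ) : ℕ → Γ
  | 0 => 1
  | n + 1 => walk g n * g n

/-- The law of the sequence of increments: independent, each with distribution `μ`. -/
def incrementLaw {Γ : Type*} [MeasurableSpace Γ] (μ : Measure Γ) [IsProbabilityMeasure μ] :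
    Measure (ℕ → Γ) :=
  Measure.infinitePi (fun _ : ℕ => μ)

/-- In the hyperbolic plane a point of a geodesic segment is determined by its distances to the
endpoints. -/
theorem UpperHalfPlane.eq_of_between {p q x y : UpperHalfPlane}
    (h : dist p x + dist x q = dist p q) (h₁ : dist p y = dist p x) (h₂ : dist y q = dist x q) :
    x = y := by
  by_contra hne
  have key : ∀ z : UpperHalfPlane, dist x z = dist y z →
      dist (UpperHalfPlane.mk (midpoint ℝ (x : ℂ) (y : ℂ)) (by
        have := x.im_pos
        have := y.im_pos
        simp [midpoint_eq_smul_add]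
        positivity)) z < dist x z := by
    intro z hz
    rw [UpperHalfPlane.dist_lt_iff_dist_coe_center_lt]
    have e1 := (UpperHalfPlane.dist_eq_iff_dist_coe_center_eq (z := x) (w := z)
      (r := dist x z)).1 rfl
    have e2 := (UpperHalfPlane.dist_eq_iff_dist_coe_center_eq (z := y) (w := z)
      (r := dist x z)).1 hz.symm
    set c : ℂ := (UpperHalfPlane.center z (dist x z) : ℂ)
    have hne' : (x : ℂ) - c ≠ (y : ℂ) - c := by
      intro h'
      exact hne (UpperHalfPlane.ext (sub_left_injective h'))
    rw [dist_eq_norm] at e1 e2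
    have := (norm_midpoint_lt_iff (e1.trans e2.symm)).2 hne'
    rw [e1] at this
    convert this using 1
    rw [dist_eq_norm]
    congr 1
    simp [midpoint_eq_smul_add]
    ring
  have k1 := key p (by rw [dist_comm x, dist_comm y, h₁])
  have k2 := key q h₂.symm
  have := dist_triangle_left p q (UpperHalfPlane.mk (midpoint ℝ (x : ℂ) (y : ℂ)) (by
        have := x.im_pos
        have := y.im_pos
        simp [midpoint_eq_smul_add]
        positivity))
  rw [dist_comm x p] at k1
  linarith

/-- In a `CAT(-1)` space the F-ake distance is the integral along any line through the two
points. -/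
theorem fakeDist_eq_integral {X : Type*} [MetricSpace X] (hX : IsCATNegOne X)
    (F : UnitTangent X → ℝ) {x y : X} (ℓ : GeodesicLine X) (h0 : ℓ.toFun 0 = x)
    (h1 : ℓ.toFun (dist x y) = y) :
    fakeDist F x y = ∫ t in (0 : ℝ)..dist x y, F (ℓ.tangent t) := by
  have hex : ∃ ℓ : GeodesicLine X, ℓ.toFun 0 = x ∧ ℓ.toFun (dist x y) = y := ⟨ℓ, h0, h1⟩
  rw [fakeDist, dif_pos hex]
  obtain ⟨m0, m1⟩ := hex.choose_spec
  set m := hex.choose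
  have between : ∀ (k : GeodesicLine X), k.toFun 0 = x → k.toFun (dist x y) = y →
      ∀ t ∈ Set.Icc 0 (dist x y), dist x (k.toFun t) = t ∧ dist (k.toFun t) y = dist x y - t := by
    intro k k0 k1 t ht
    constructor
    · conv_lhs => rw [← k0]
      rw [k.isometry.dist_eq, Real.dist_eq, zero_sub, abs_neg, abs_of_nonneg ht.1]
    · conv_lhs => rw [← k1]
      rw [k.isometry.dist_eq, Real.dist_eq, abs_sub_comm, abs_of_nonneg (by linarith [ht.2])]
  have uniq : ∀ t ∈ Set.Icc 0 (dist x y), m.toFun t = ℓ.toFun t := by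
    intro t ht
    obtain ⟨a1, a2⟩ := between m m0 m1 t ht
    obtain ⟨b1, b2⟩ := between ℓ h0 h1 t ht
    obtain ⟨p', q', r', e1, -, e3, hc⟩ := hX.comparison x y y
    obtain ⟨u, v, c1, c2, c3, c4, c5⟩ := hc (m.toFun t) (ℓ.toFun t)
      (by rw [a1, a2]; ring) (by rw [b1, b2]; ring)
    have hqr : q' = r' := by rw [← dist_eq_zero, e3, dist_self]
    subst hqr
    have huv : u = v := UpperHalfPlane.eq_of_between (p := p') (q := q')
      (by rw [c1, c2, e1, a1, a2]; ring) (by rw [c3, c1, a1, b1]) (by rw [c4, c2, a2, b2])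
    rw [huv, dist_self] at c5
    exact dist_le_zero.1 c5
  rw [intervalIntegral.integral_of_le dist_nonneg, intervalIntegral.integral_of_le dist_nonneg,
    integral_Ioc_eq_integral_Ioo, integral_Ioc_eq_integral_Ioo]
  refine setIntegral_congr_fun measurableSet_Ioo fun t ht => ?_
  have : m.tangent t = ℓ.tangent t := by
    refine Quotient.sound ?_
    have hmem : ∀ᶠ s : ℝ in 𝓝 0, t + s ∈ Set.Ioo 0 (dist x y) := by
      have : Tendsto (fun s : ℝ => t + s) (𝓝 0) (𝓝 t) := by
        have hc : Continuous fun s : ℝ => t + s := by fun_prop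
        simpa using hc.tendsto 0
      exact this (isOpen_Ioo.mem_nhds ht)
    filter_upwards [hmem] with s hs
    exact uniq _ ⟨hs.1.le, hs.2.le⟩
  simp only [this]

end

/-! Put `φ(g) = d_F(o, g o)`. By invariance of `F`, `φ(gh) - φ(g) - φ(h)` measures how far `d_F` is
from being additive at the point `g o` on the way from `o` to `gh o`. Triangles in `X` are tripods
up to a bounded error and `d_F` is additive along geodesics, so this defect comes from two legs
whose length is the Gromov product `ρ = (o | gh o)_{g o}`, and from bounded moves of endpoints near
the branch point. As `F` grows subexponentially away from the orbit of `o`, the defect is at most `K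
exp(ε ρ)` for every `ε > 0` (`HasHolderControl.exists_abs_defect_le`).

Moreover `ρ = (g⁻¹ o | h o)_o`, and for a random walk `h` is independent of `g`. So it suffices to
bound `E exp(ε (z | ω_n o)_o)` uniformly in `n` and `z`
(`IsNonelementaryAction.exists_integral_exp_gromovProduct_le`). Four Schottky elements, charged by a
convolution power of `μ`, push away from every `z` on average; this gives a positive drift uniform
in `z`, then a factor `ρ < 1` for `E exp(-ε · gain)`, and hence a contracting recursion for the
exponential moments of Gromov products.

Thus `φ(ω_n)` is a sum of stationary independent blocks up to errors bounded in `L⁴`. Its means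
divided by `n` converge by Fekete's lemma. Cutting `k³` steps into `k²` blocks of length `k` shows
that the variance at time `k³` is `O(k⁴)`, so almost sure convergence holds along the cubes, and
fourth moments control the gaps between cubes (`IsAlmostAdditive.exists_ae_tendsto_div`). -/

/-! ### Gromov hyperbolicity of `CAT(-1)` spaces -/

/-- Ptolemy's inequality for the hyperbolic plane. -/
theorem UpperHalfPlane.sinh_half_dist_ptolemy (x y z w : UpperHalfPlane) :
    Real.sinh (dist x y / 2) * Real.sinh (dist z w / 2) ≤
      Real.sinh (dist x z / 2) * Real.sinh (dist y w / 2) +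
        Real.sinh (dist x w / 2) * Real.sinh (dist y z / 2) := by
  -- `sinh (d/2)` is the Euclidean distance divided by `2 √(im · im)`. Each of the three products
  -- involves all four points once, so all have the same denominator and Euclidean Ptolemy applies.
  have hP := EuclideanGeometry.mul_dist_le_mul_dist_add_mul_dist (x : ℂ) (z : ℂ) (y : ℂ) (w : ℂ)
  simp only [UpperHalfPlane.sinh_half_dist]
  have hx := Real.sqrt_pos.2 x.im_pos
  have hy := Real.sqrt_pos.2 y.im_pos
  have hz := Real.sqrt_pos.2 z.im_pos
  have hw := Real.sqrt_pos.2 w.im_pos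
  rw [Real.sqrt_mul x.im_pos.le, Real.sqrt_mul x.im_pos.le, Real.sqrt_mul x.im_pos.le,
    Real.sqrt_mul y.im_pos.le, Real.sqrt_mul y.im_pos.le, Real.sqrt_mul z.im_pos.le]
  have hD : 0 < 4 * (√x.im * √y.im * √z.im * √w.im) := by positivity
  have e1 : dist (x : ℂ) y / (2 * (√x.im * √y.im)) * (dist (z : ℂ) w / (2 * (√z.im * √w.im))) =
      dist (x : ℂ) y * dist (z : ℂ) w / (4 * (√x.im * √y.im * √z.im * √w.im)) := by
    field_simp; ring
  have e2 : dist (x : ℂ) z / (2 * (√x.im * √z.im)) * (dist (y : ℂ) w / (2 * (√y.im * √w.im))) =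
      dist (x : ℂ) z * dist (y : ℂ) w / (4 * (√x.im * √y.im * √z.im * √w.im)) := by
    field_simp; ring
  have e3 : dist (x : ℂ) w / (2 * (√x.im * √w.im)) * (dist (y : ℂ) z / (2 * (√y.im * √z.im))) =
      dist (x : ℂ) w * dist (y : ℂ) z / (4 * (√x.im * √y.im * √z.im * √w.im)) := by
    field_simp; ring
  rw [e1, e2, e3, ← add_div]
  refine div_le_div_of_nonneg_right ?_ hD.le
  rw [dist_comm (y : ℂ) z]
  linarith [mul_comm (dist (z : ℂ) y) (dist (x : ℂ) w)]

/-- The four-point inequality in the hyperbolic plane. -/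
theorem UpperHalfPlane.dist_add_dist_le_max (x y z w : UpperHalfPlane) :
    dist x y + dist z w ≤ max (dist x z + dist y w) (dist x w + dist y z) + 5 := by
  have hlog : Real.log 2 < 0.7 := Real.log_two_lt_d9.trans (by norm_num)
  have hlog0 : 0 < Real.log 2 := Real.log_pos (by norm_num)
  -- When one of the two distances is short, the triangle inequality suffices; otherwise `sinh` is
  -- comparable to `exp`.
  have small : ∀ x y z w : UpperHalfPlane, dist x y ≤ 2 * Real.log 2 →
      dist x y + dist z w ≤ max (dist x z + dist y w) (dist x w + dist y z) + 5 := by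
    intro x y z w h
    have h1 := dist_triangle4 z x y w
    rw [dist_comm z x] at h1
    have := le_max_left (dist x z + dist y w) (dist x w + dist y z)
    linarith
  by_cases h1 : dist x y ≤ 2 * Real.log 2
  · exact small x y z w h1
  by_cases h2 : dist z w ≤ 2 * Real.log 2
  · have := small z w x y h2
    rw [dist_comm z x, dist_comm w y, dist_comm z y, dist_comm w x,
      add_comm (dist y z) (dist x w)] at this
    linarith
  push Not at h1 h2
  have lower : ∀ u : ℝ, 2 * Real.log 2 < u → Real.exp (u / 2) / 4 ≤ Real.sinh (u / 2) := by
    intro u hu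
    have h3 : 2 ≤ Real.exp (u / 2) := by
      rw [← Real.log_le_iff_le_exp (by norm_num)]; linarith
    have h4 : Real.exp (-(u / 2)) ≤ 1 := Real.exp_le_one_iff.2 (by linarith)
    rw [Real.sinh_eq]; linarith
  have upper : ∀ u : ℝ, 0 ≤ u → Real.sinh (u / 2) ≤ Real.exp (u / 2) / 2 := by
    intro u _
    have := Real.exp_pos (-(u / 2))
    rw [Real.sinh_eq]; linarith
  have snn : ∀ u : ℝ, 0 ≤ u → 0 ≤ Real.sinh (u / 2) := fun u hu =>
    Real.sinh_nonneg_iff.2 (by linarith)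
  set T := max (dist x z + dist y w) (dist x w + dist y z)
  have prod : ∀ u v : ℝ, 0 ≤ u → 0 ≤ v → u + v ≤ T →
      Real.sinh (u / 2) * Real.sinh (v / 2) ≤ Real.exp (T / 2) / 4 := by
    intro u v hu hv huv
    calc Real.sinh (u / 2) * Real.sinh (v / 2)
        ≤ (Real.exp (u / 2) / 2) * (Real.exp (v / 2) / 2) :=
          mul_le_mul (upper u hu) (upper v hv) (snn v hv) (by positivity)
      _ = Real.exp ((u + v) / 2) / 4 := by rw [add_div, Real.exp_add]; ring
      _ ≤ Real.exp (T / 2) / 4 := by gcongr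
  have key : Real.exp ((dist x y + dist z w) / 2) / 16 ≤ Real.exp (T / 2) / 2 := by
    calc Real.exp ((dist x y + dist z w) / 2) / 16
        = (Real.exp (dist x y / 2) / 4) * (Real.exp (dist z w / 2) / 4) := by
          rw [add_div, Real.exp_add]; ring
      _ ≤ Real.sinh (dist x y / 2) * Real.sinh (dist z w / 2) :=
          mul_le_mul (lower _ h1) (lower _ h2) (by positivity) (snn _ dist_nonneg)
      _ ≤ _ := UpperHalfPlane.sinh_half_dist_ptolemy x y z w
      _ ≤ Real.exp (T / 2) / 4 + Real.exp (T / 2) / 4 :=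
          add_le_add (prod _ _ dist_nonneg dist_nonneg (le_max_left _ _))
            (prod _ _ dist_nonneg dist_nonneg (le_max_right _ _))
      _ = Real.exp (T / 2) / 2 := by ring
  -- The lost factor `8` costs `2 · 3 log 2 < 5`.
  have key2 : Real.exp ((dist x y + dist z w) / 2) ≤ Real.exp (T / 2 + 3 * Real.log 2) := by
    rw [Real.exp_add, show (3 : ℝ) * Real.log 2 = Real.log 8 by
      rw [show (8 : ℝ) = 2 ^ (3 : ℕ) by norm_num, Real.log_pow]; norm_num,
      Real.exp_log (by norm_num)]
    linarith
  have := Real.exp_le_exp.1 key2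
  linarith

/-- The Gromov product `(x | y)_p`. -/
noncomputable def gromovProduct {X : Type*} [MetricSpace X] (p x y : X) : ℝ :=
  (dist p x + dist p y - dist x y) / 2

/-- Gromov's four-point condition. -/
def IsGromovHyperbolic (X : Type*) [MetricSpace X] (δ : ℝ) : Prop :=
  ∀ p x y z : X,
    min (gromovProduct p x y) (gromovProduct p y z) - δ ≤ gromovProduct p x z

section GromovProduct

variable {X : Type*} [MetricSpace X]

theorem gromovProduct_comm (p x y : X) : gromovProduct p x y = gromovProduct p y x := by
  rw [gromovProduct, gromovProduct, dist_comm x y]; ring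

theorem gromovProduct_nonneg (p x y : X) : 0 ≤ gromovProduct p x y := by
  have := dist_triangle_left x y p
  unfold gromovProduct; linarith

theorem gromovProduct_le_left (p x y : X) : gromovProduct p x y ≤ dist p x := by
  have := dist_triangle p x y
  unfold gromovProduct; linarith

theorem gromovProduct_le_right (p x y : X) : gromovProduct p x y ≤ dist p y := by
  rw [gromovProduct_comm]; exact gromovProduct_le_left p y x

theorem dist_eq_gromovProduct (p x y : X) :
    dist x y = dist p x + dist p y - 2 * gromovProduct p x y := by
  unfold gromovProduct; ring

theorem gromovProduct_smul {Γ : Type*} [Group Γ] [MulAction Γ X] [IsIsometricSMul Γ X]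
    (g : Γ) (p x y : X) : gromovProduct (g • p) (g • x) (g • y) = gromovProduct p x y := by
  simp [gromovProduct]

theorem IsGromovHyperbolic.nonneg [Nonempty X] {δ : ℝ} (h : IsGromovHyperbolic X δ) : 0 ≤ δ := by
  obtain ⟨x⟩ := ‹Nonempty X›
  have := h x x x x
  simp [gromovProduct] at this
  exact this

theorem gromovProduct_eq_of_between {p x q : X} (h : dist p q + dist q x = dist p x) :
    gromovProduct p q x = dist p q := by
  unfold gromovProduct; linarith

/-- Points at the same distance from `p` on two sides `[p, x]`, `[p, y]` of a triangle are close
if this distance is at most the Gromov product. -/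
theorem IsGromovHyperbolic.dist_le_of_between {δ : ℝ} (hδ : IsGromovHyperbolic X δ)
    {p x y a b : X} (ha : dist p a + dist a x = dist p x) (hb : dist p b + dist b y = dist p y)
    (hab : dist p a = dist p b) (hle : dist p a ≤ gromovProduct p x y) : dist a b ≤ 4 * δ := by
  have h1 := hδ p a x y
  rw [gromovProduct_eq_of_between ha, min_eq_left hle] at h1
  have h2 := hδ p a y b
  rw [gromovProduct_comm p y b, gromovProduct_eq_of_between hb, ← hab] at h2
  have : Nonempty X := ⟨p⟩
  have h3 : dist p a - δ ≤ min (gromovProduct p a y) (dist p a) :=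
    le_min h1 (by linarith [hδ.nonneg])
  rw [dist_eq_gromovProduct p a b]
  linarith

end GromovProduct

/-- Passing from sums of two distances to Gromov products halves the additive error `5`. -/
theorem UpperHalfPlane.isGromovHyperbolic : IsGromovHyperbolic UpperHalfPlane (5 / 2) := by
  intro p x y z
  have h := UpperHalfPlane.dist_add_dist_le_max x z p y
  simp only [gromovProduct]
  rw [dist_comm x p, dist_comm z p, dist_comm z y] at h
  rcases le_total (dist p x + dist y z) (dist x y + dist p z) with h' | h'
  · rw [max_eq_right h'] at h
    have := min_le_left ((dist p x + dist p y - dist x y) / 2)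
      ((dist p y + dist p z - dist y z) / 2)
    rw [min_def]; split_ifs <;> linarith
  · rw [max_eq_left h'] at h
    rw [min_def]; split_ifs <;> linarith

theorem IsGeodesicSpace.exists_between {X : Type*} [MetricSpace X] (hX : IsGeodesicSpace X)
    (x y : X) {t : ℝ} (ht : t ∈ Set.Icc 0 (dist x y)) :
    ∃ q, dist x q = t ∧ dist q y = dist x y - t := by
  obtain ⟨γ, h0, h1, h⟩ := hX x y
  have a0 := h 0 ⟨le_rfl, dist_nonneg⟩ t ht
  have a1 := h t ht (dist x y) ⟨dist_nonneg, le_rfl⟩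
  rw [h0, zero_sub, abs_neg, abs_of_nonneg ht.1] at a0
  rw [h1, abs_sub_comm, abs_of_nonneg (sub_nonneg.2 ht.2)] at a1
  exact ⟨γ t, a0, a1⟩

/-- The comparison axiom sees only one triangle at a time, so the four-point condition cannot be
pulled back directly. Thinness of triangles can: points at distance `t` from `p` on two sides are
within `4 · 5/2 = 10`. Applying this to the triangles `p, x, y` and `p, y, z` bounds `d(x, z)` by a
path through three such points. -/
theorem IsCATNegOne.isGromovHyperbolic {X : Type*} [MetricSpace X] (hX : IsCATNegOne X) :
    IsGromovHyperbolic X 10 := by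
  have close : ∀ p x y a b : X, dist p a + dist a x = dist p x →
      dist p b + dist b y = dist p y → dist p a = dist p b →
      dist p a ≤ gromovProduct p x y → dist a b ≤ 10 := by
    intro p x y a b ha hb hab hle
    obtain ⟨p', x', y', e1, e2, e3, hc⟩ := hX.comparison p x y
    obtain ⟨a', b', f1, f2, f3, f4, f5⟩ := hc a b ha hb
    have := UpperHalfPlane.isGromovHyperbolic.dist_le_of_between (p := p') (x := x') (y := y')
      (a := a') (b := b') (by rw [f1, f2, e1, ha]) (by rw [f3, f4, e2, hb])
      (by rw [f1, f3, hab]) (by rw [f1]; unfold gromovProduct at hle ⊢; rwa [e1, e2, e3])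
    linarith
  intro p x y z
  set t := min (gromovProduct p x y) (gromovProduct p y z)
  have t0 : 0 ≤ t := le_min (gromovProduct_nonneg _ _ _) (gromovProduct_nonneg _ _ _)
  have tx : t ≤ dist p x := (min_le_left _ _).trans (gromovProduct_le_left _ _ _)
  have ty : t ≤ dist p y := (min_le_left _ _).trans (gromovProduct_le_right _ _ _)
  have tz : t ≤ dist p z := (min_le_right _ _).trans (gromovProduct_le_right _ _ _)
  obtain ⟨a, a1, a2⟩ := hX.geodesic.exists_between p x ⟨t0, tx⟩
  obtain ⟨b, b1, b2⟩ := hX.geodesic.exists_between p y ⟨t0, ty⟩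
  obtain ⟨c, c1, c2⟩ := hX.geodesic.exists_between p z ⟨t0, tz⟩
  have hab := close p x y a b (by linarith) (by linarith) (by linarith)
    (by rw [a1]; exact min_le_left _ _)
  have hbc := close p y z b c (by linarith) (by linarith) (by linarith)
    (by rw [b1]; exact min_le_right _ _)
  have h1 := dist_triangle4 x a c z
  have h2 := dist_triangle a b c
  rw [dist_comm x a] at h1
  unfold gromovProduct
  linarith

/-! ### Estimates for the F-ake distance -/

section FakeDist

variable {X : Type*} [MetricSpace X] {F : UnitTangent X → ℝ}

theorem GeodesicLine.foot_tangent (ℓ : GeodesicLine X) (t : ℝ) :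
    (ℓ.tangent t).foot = ℓ.toFun t := by
  change (ℓ.flow t).toFun 0 = ℓ.toFun t
  simp [GeodesicLine.flow]

theorem GeodesicLine.tangent_flow (ℓ : GeodesicLine X) (s t : ℝ) :
    (ℓ.flow s).tangent t = ℓ.tangent (s + t) := by
  unfold GeodesicLine.tangent
  congr 1
  simp [GeodesicLine.flow, add_assoc]

theorem GeodesicLine.dist_toFun (ℓ : GeodesicLine X) {s t : ℝ} (h : s ≤ t) :
    dist (ℓ.toFun s) (ℓ.toFun t) = t - s := by
  rw [ℓ.isometry.dist_eq, Real.dist_eq, abs_sub_comm, abs_of_nonneg (sub_nonneg.2 h)]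

theorem fakeDist_self (F : UnitTangent X → ℝ) (x : X) : fakeDist F x x = 0 := by
  unfold fakeDist
  split_ifs <;> simp

theorem fakeDist_smul {Γ : Type*} [Group Γ] [MulAction Γ X] [IsIsometricSMul Γ X]
    (hX : IsCATNegOne X) (hc : IsGeodesicallyComplete X) (hF : IsPotential Γ F)
    (g : Γ) (x y : X) : fakeDist F (g • x) (g • y) = fakeDist F x y := by
  rcases eq_or_ne x y with rfl | hne
  · rw [fakeDist_self, fakeDist_self]
  obtain ⟨ℓ, h0, h1⟩ := hc x y hne
  rw [fakeDist_eq_integral hX F ℓ h0 h1,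
    fakeDist_eq_integral hX F (ℓ.translate g) (by simp [GeodesicLine.translate, h0])
      (by simp [GeodesicLine.translate, h1]), dist_smul]
  simp only [hF.invariant]

/-- The F-ake distance is additive along geodesics. -/
theorem fakeDist_split {Γ : Type*} [Group Γ] [MulAction Γ X] [IsIsometricSMul Γ X]
    (hX : IsCATNegOne X) (hc : IsGeodesicallyComplete X) (hF : IsPotential Γ F)
    (x y : X) {t : ℝ} (ht : t ∈ Set.Icc 0 (dist x y)) :
    ∃ q, dist x q = t ∧ dist q y = dist x y - t ∧
      fakeDist F x y = fakeDist F x q + fakeDist F q y := by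
  rcases eq_or_ne x y with rfl | hne
  · rw [dist_self] at ht
    obtain rfl : t = 0 := le_antisymm ht.2 ht.1
    exact ⟨x, by simp, by simp, by simp [fakeDist_self]⟩
  obtain ⟨ℓ, h0, h1⟩ := hc x y hne
  have d0 : dist x (ℓ.toFun t) = t := by
    rw [← h0, ℓ.dist_toFun ht.1, sub_zero]
  have d1 : dist (ℓ.toFun t) y = dist x y - t := by
    conv_lhs => rw [← h1]
    rw [ℓ.dist_toFun ht.2]
  refine ⟨ℓ.toFun t, d0, d1, ?_⟩
  rw [fakeDist_eq_integral hX F ℓ h0 h1,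
    fakeDist_eq_integral hX F ℓ h0 (y := ℓ.toFun t) (by rw [d0]),
    fakeDist_eq_integral hX F (ℓ.flow t) (x := ℓ.toFun t) (y := y) (by simp [GeodesicLine.flow])
      (by simp [GeodesicLine.flow, d1, h1]), d0, d1]
  simp only [GeodesicLine.tangent_flow]
  rw [intervalIntegral.integral_comp_add_left (fun s => F (ℓ.tangent s))]
  have hint : ∀ a b : ℝ, IntervalIntegrable (fun s => F (ℓ.tangent s)) volume a b := fun a b =>
    ((hF.locallyIntegrable ℓ).integrableOn_isCompact isCompact_uIcc).intervalIntegrable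
  rw [add_zero, add_sub_cancel, intervalIntegral.integral_add_adjacent_intervals (hint _ _)
    (hint _ _)]

theorem abs_fakeDist_le (hX : IsCATNegOne X) (hc : IsGeodesicallyComplete X) (x y : X) {K : ℝ}
    (hK : ∀ v : UnitTangent X, dist x v.foot + dist v.foot y = dist x y → |F v| ≤ K) :
    |fakeDist F x y| ≤ K * dist x y := by
  rcases eq_or_ne x y with rfl | hne
  · simp [fakeDist_self]
  obtain ⟨ℓ, h0, h1⟩ := hc x y hne
  rw [fakeDist_eq_integral hX F ℓ h0 h1, ← Real.norm_eq_abs]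
  refine (intervalIntegral.norm_integral_le_of_norm_le_const (C := K) fun t ht => ?_).trans_eq
    (by rw [sub_zero, abs_of_nonneg dist_nonneg])
  rw [Set.uIoc_of_le dist_nonneg] at ht
  refine hK _ ?_
  have d0 : dist x (ℓ.toFun t) = t := by
    rw [← h0, ℓ.dist_toFun ht.1.le, sub_zero]
  have d1 : dist (ℓ.toFun t) y = dist x y - t := by
    conv_lhs => rw [← h1]
    rw [ℓ.dist_toFun ht.2]
  rw [ℓ.foot_tangent, d0, d1]
  ring

/-- The bound `hK0` is needed when no vector has its footpoint in the ball, where `sSup` takes the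
value `0`. -/
theorem maxAbsOnBall_le {x : X} {r K : ℝ} (hK0 : 0 ≤ K)
    (hK : ∀ v : UnitTangent X, dist x v.foot ≤ r → |F v| ≤ K) : maxAbsOnBall F x r ≤ K := by
  refine Real.sSup_le ?_ hK0
  rintro _ ⟨v, hv, rfl⟩
  exact hK v (by rw [dist_comm]; exact hv)

/-- Coarse continuity of the F-ake distance in its endpoints. -/
theorem HasHolderControl.exists_abs_sub_le (hX : IsGeodesicSpace X) (hHC : HasHolderControl F) :
    ∃ c > 0, ∀ (N : ℕ) (K : ℝ) (x a q : X), 0 ≤ K → dist a q ≤ N →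
      (∀ v : UnitTangent X, dist a v.foot ≤ N → |F v| ≤ K) →
      |fakeDist F x q - fakeDist F x a| ≤ N * (c + K) ∧
      |fakeDist F q x - fakeDist F a x| ≤ N * (c + K) := by
  obtain ⟨c, hc, c₂, hc₂, H⟩ := hHC.holder
  refine ⟨c, hc, fun N => ?_⟩
  -- The Hölder control only allows moves of length at most `1`, so the endpoint travels from `a` to
  -- `q` in `N` such moves.
  induction N with
  | zero =>
    intro K x a q _ h _
    obtain rfl : a = q := dist_le_zero.1 (by simpa using h)
    simp
  | succ N ih =>
    intro K x a q hK h hv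
    obtain ⟨m, m1, m2⟩ := hX.exists_between a q (t := min N (dist a q))
      ⟨le_min (Nat.cast_nonneg N) dist_nonneg, min_le_right _ _⟩
    push_cast at h hv ⊢
    have haN : dist a m ≤ N := m1.trans_le (min_le_left _ _)
    have hmq : dist m q ≤ 1 := by
      rw [m2, min_def]; split_ifs <;> linarith
    obtain ⟨i1, i2⟩ := ih K x a m hK haN fun v hv' => hv v (by linarith)
    have hmax : maxAbsOnBall F m (dist m q) ≤ K := maxAbsOnBall_le hK fun v hv' => hv v (by
      have := dist_triangle a m v.foot
      linarith)
    have hpow : dist m q ^ c₂ ≤ 1 := Real.rpow_le_one dist_nonneg hmq hc₂.1.le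
    have hpow0 : 0 ≤ dist m q ^ c₂ := Real.rpow_nonneg dist_nonneg _
    have step : (c + maxAbsOnBall F m (dist m q)) * dist m q ^ c₂ ≤ c + K := by
      calc (c + maxAbsOnBall F m (dist m q)) * dist m q ^ c₂ ≤ (c + K) * dist m q ^ c₂ := by gcongr
        _ ≤ (c + K) * 1 := by gcongr
        _ = c + K := mul_one _
    have s1 := H x m x q (by simp) hmq
    have s2 := H m x q x hmq (by simp)
    -- The endpoint that stays fixed contributes `0 ^ c₂ = 0`, so no bound on `F` near `x` is
    -- needed.
    rw [dist_self, Real.zero_rpow hc₂.1.ne', mul_zero, zero_add] at s1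
    rw [dist_self, Real.zero_rpow hc₂.1.ne', mul_zero, add_zero] at s2
    constructor
    · have := abs_sub_le (fakeDist F x q) (fakeDist F x m) (fakeDist F x a)
      linarith
    · have := abs_sub_le (fakeDist F q x) (fakeDist F m x) (fakeDist F a x)
      linarith

/-- A potential grows subexponentially with the distance to an orbit. -/
theorem HasHolderControl.exists_abs_le_exp {Γ : Type*} [Group Γ] [MulAction Γ X]
    [IsIsometricSMul Γ X] (hHC : HasHolderControl F) (hF : IsPotential Γ F)
    (ℓ : GeodesicLine X) (o : X) {ε : ℝ} (hε : 0 < ε) :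
    ∃ K ≥ 0, ∀ (g : Γ) (v : UnitTangent X), |F v| ≤ K * Real.exp (ε * dist (g • o) v.foot) := by
  obtain ⟨b, hb, H⟩ := hHC.subexponential (Real.exp ε) (Real.one_lt_exp_iff.2 hε)
  refine ⟨|F (ℓ.tangent 0)| + b * Real.exp (ε * dist o (ℓ.toFun 0)), by positivity, fun g v => ?_⟩
  -- The reference vector is carried along by `g`. By invariance `F` has the same value on all its
  -- translates, which makes `K` independent of `g`.
  have h1 := H v ((ℓ.translate g).tangent 0)
  rw [hF.invariant, GeodesicLine.foot_tangent, ← Real.exp_mul] at h1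
  have h2 : dist v.foot ((ℓ.translate g).toFun 0) ≤
      dist o (ℓ.toFun 0) + dist (g • o) v.foot := by
    have := dist_triangle_left v.foot (g • ℓ.toFun 0) (g • o)
    rw [dist_smul] at this
    change dist v.foot (g • ℓ.toFun 0) ≤ _
    linarith
  have h3 : Real.exp (ε * dist v.foot ((ℓ.translate g).toFun 0)) ≤
      Real.exp (ε * dist o (ℓ.toFun 0)) * Real.exp (ε * dist (g • o) v.foot) := by
    rw [← Real.exp_add, ← mul_add]
    gcongr
  have h4 : |F v| ≤ |F (ℓ.tangent 0)| + |F v - F (ℓ.tangent 0)| := by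
    have := abs_add_le (F (ℓ.tangent 0)) (F v - F (ℓ.tangent 0))
    rwa [add_sub_cancel] at this
  have h5 : 1 ≤ Real.exp (ε * dist (g • o) v.foot) := Real.one_le_exp (by positivity)
  calc |F v| ≤ |F (ℓ.tangent 0)| * 1 + b * (Real.exp (ε * dist o (ℓ.toFun 0)) *
        Real.exp (ε * dist (g • o) v.foot)) := by
        have := mul_le_mul_of_nonneg_left h3 hb.le
        linarith
    _ ≤ |F (ℓ.tangent 0)| * Real.exp (ε * dist (g • o) v.foot) +
        b * (Real.exp (ε * dist o (ℓ.toFun 0)) * Real.exp (ε * dist (g • o) v.foot)) := by gcongr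
    _ = _ := by ring

/-- Used to absorb a factor equal to a length into an exponential with a slightly larger rate. -/
theorem le_inv_mul_exp_mul {ε : ℝ} (hε : 0 < ε) (u : ℝ) : u ≤ ε⁻¹ * Real.exp (ε * u) := by
  rw [← div_eq_inv_mul, le_div_iff₀ hε]
  linarith [Real.add_one_le_exp (ε * u)]

/-- The defect of additivity of the F-ake distance at a point of an orbit is controlled by the
Gromov product. -/
theorem HasHolderControl.exists_abs_defect_le {Γ : Type*} [Group Γ] [MulAction Γ X]
    [IsIsometricSMul Γ X] (hX : IsCATNegOne X) (hc : IsGeodesicallyComplete X)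
    (hHC : HasHolderControl F) (hF : IsPotential Γ F)
    (ℓ : GeodesicLine X) (o : X) {ε : ℝ} (hε : 0 < ε) :
    ∃ K ≥ 0, ∀ (g : Γ) (x z : X),
      |fakeDist F x z - fakeDist F x (g • o) - fakeDist F (g • o) z| ≤
        K * Real.exp (ε * gromovProduct (g • o) x z) := by
  obtain ⟨c, hc0, hmove⟩ := hHC.exists_abs_sub_le hX.geodesic
  -- Half of the rate is kept in reserve for the length `ρ` of the legs.
  obtain ⟨K, hK, hgrow⟩ := hHC.exists_abs_le_exp hF ℓ o (half_pos hε)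
  -- Two moves of length at most `40` give the first two terms; two legs of length `ρ` give the
  -- last.
  refine ⟨80 * c + 80 * (K * Real.exp (ε / 2 * 40)) + 2 * K * (ε / 2)⁻¹, by positivity,
    fun g x z => ?_⟩
  set p := g • o with hp
  set ρ := gromovProduct p x z with hρ
  have hρ0 : 0 ≤ ρ := gromovProduct_nonneg p x z
  have hρt : ρ = dist x p - gromovProduct x p z := by
    rw [hρ]; unfold gromovProduct; rw [dist_comm p x]; ring
  have hρz : dist p z - ρ = gromovProduct z p x := by
    rw [hρ]; unfold gromovProduct; rw [dist_comm z p, dist_comm z x]; ring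
  -- The points `q`, `a`, `b` are the inner points of the triangle `x, p, z` on `[x, z]`, `[x, p]`,
  -- `[p, z]`. They correspond to the centre of the comparison tripod, so `a` and `b` are close to
  -- `q` and at distance `ρ` from `p`.
  obtain ⟨q, q1, q2, q3⟩ := fakeDist_split hX hc hF x z (t := gromovProduct x p z)
    ⟨gromovProduct_nonneg _ _ _, gromovProduct_le_right _ _ _⟩
  obtain ⟨a, a1, a2, a3⟩ := fakeDist_split hX hc hF x p (t := gromovProduct x p z)
    ⟨gromovProduct_nonneg _ _ _, gromovProduct_le_left _ _ _⟩
  obtain ⟨b, b1, b2, b3⟩ := fakeDist_split hX hc hF p z (t := ρ)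
    ⟨hρ0, gromovProduct_le_right _ _ _⟩
  rw [← hρt] at a2
  rw [hρz] at b2
  have hqz : dist q z = gromovProduct z p x := by
    rw [q2]; unfold gromovProduct; rw [dist_comm z p, dist_comm z x, dist_comm x p]; ring
  have haq : dist a q ≤ 4 * 10 := hX.isGromovHyperbolic.dist_le_of_between (p := x) (x := p)
    (y := z) (by linarith) (by linarith) (by linarith) a1.le
  have hbq : dist b q ≤ 4 * 10 := by
    refine hX.isGromovHyperbolic.dist_le_of_between (p := z) (x := p) (y := x) ?_ ?_ ?_ ?_
    · rw [dist_comm z b, dist_comm b p, dist_comm z p]; linarith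
    · rw [dist_comm z q, dist_comm q x, dist_comm z x]; linarith
    · rw [dist_comm z b, dist_comm z q]; linarith
    · rw [dist_comm z b, b2]
  have e1 : 1 ≤ Real.exp (ε / 2 * ρ) := Real.one_le_exp (by positivity)
  have hball : ∀ y, dist p y = ρ → ∀ v : UnitTangent X, dist y v.foot ≤ (40 : ℕ) →
      |F v| ≤ K * (Real.exp (ε / 2 * 40) * Real.exp (ε / 2 * ρ)) := by
    intro y hy v hv
    refine (hgrow g v).trans ?_
    rw [← Real.exp_add, ← mul_add]
    have := dist_triangle p y v.foot
    push_cast at hv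
    gcongr
    linarith
  have hb0 : 0 ≤ K * (Real.exp (ε / 2 * 40) * Real.exp (ε / 2 * ρ)) := by positivity
  have m1 := (hmove 40 _ x a q hb0 (by push_cast; linarith) (hball a (by rw [dist_comm, a2]))).1
  have m2 := (hmove 40 _ z b q hb0 (by push_cast; linarith) (hball b b1)).2
  have m3 : |fakeDist F a p| ≤ K * Real.exp (ε / 2 * ρ) * dist a p := by
    refine abs_fakeDist_le hX hc a p fun v hv => (hgrow g v).trans ?_
    have : dist p v.foot ≤ ρ := by
      rw [dist_comm]; linarith [dist_nonneg (x := a) (y := v.foot)]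
    gcongr
  have m4 : |fakeDist F p b| ≤ K * Real.exp (ε / 2 * ρ) * dist p b := by
    refine abs_fakeDist_le hX hc p b fun v hv => (hgrow g v).trans ?_
    have : dist p v.foot ≤ ρ := by
      linarith [dist_nonneg (x := v.foot) (y := b)]
    gcongr
  rw [a2] at m3
  rw [b1] at m4
  have hee : Real.exp (ε * ρ) = Real.exp (ε / 2 * ρ) * Real.exp (ε / 2 * ρ) := by
    rw [← Real.exp_add]; ring_nf
  have hρe := le_inv_mul_exp_mul (half_pos hε) ρ
  set E := Real.exp (ε / 2 * ρ)
  set A := Real.exp (ε / 2 * 40)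
  push_cast at m1 m2
  have tri : |fakeDist F x z - fakeDist F x p - fakeDist F p z| ≤
      |fakeDist F x q - fakeDist F x a| + |fakeDist F q z - fakeDist F b z| +
        |fakeDist F a p| + |fakeDist F p b| := by
    rw [q3, a3, b3]
    have t1 := abs_sub_le_iff.1 (le_refl |fakeDist F x q - fakeDist F x a|)
    have t2 := abs_sub_le_iff.1 (le_refl |fakeDist F q z - fakeDist F b z|)
    have t3 := abs_le.1 (le_refl |fakeDist F a p|)
    have t4 := abs_le.1 (le_refl |fakeDist F p b|)
    rw [abs_le]
    constructor <;> linarith [t1.1, t1.2, t2.1, t2.2, t3.1, t3.2, t4.1, t4.2]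
  rw [hee]
  have hEE : E ≤ E * E := le_mul_of_one_le_left (by positivity) e1
  have f1 : c ≤ c * (E * E) := le_mul_of_one_le_right hc0.le (e1.trans hEE)
  have f2 : K * (A * E) ≤ K * A * (E * E) := by
    rw [← mul_assoc]; gcongr
  have f3 : K * E * ρ ≤ K * (ε / 2)⁻¹ * (E * E) := by
    calc K * E * ρ ≤ K * E * ((ε / 2)⁻¹ * E) := by gcongr
      _ = _ := by ring
  linarith

/-- Used with a quarter of the moment exponent, this makes the fourth power of `d_F(o, g o)`
integrable. -/
theorem HasHolderControl.exists_abs_fakeDist_le {Γ : Type*} [Group Γ] [MulAction Γ X]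
    [IsIsometricSMul Γ X] (hX : IsCATNegOne X) (hc : IsGeodesicallyComplete X)
    (hHC : HasHolderControl F) (hF : IsPotential Γ F)
    (ℓ : GeodesicLine X) (o : X) {ε : ℝ} (hε : 0 < ε) :
    ∃ K ≥ 0, ∀ y : X, |fakeDist F o y| ≤ K * Real.exp (ε * dist o y) := by
  obtain ⟨K, hK, hgrow⟩ := hHC.exists_abs_le_exp hF ℓ o (half_pos hε)
  refine ⟨K * (ε / 2)⁻¹, by positivity, fun y => ?_⟩
  have h1 : |fakeDist F o y| ≤ K * Real.exp (ε / 2 * dist o y) * dist o y := by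
    refine abs_fakeDist_le hX hc o y fun v hv => (hgrow 1 v).trans ?_
    rw [one_smul]
    have : dist o v.foot ≤ dist o y := by linarith [dist_nonneg (x := v.foot) (y := y)]
    gcongr
  refine h1.trans ?_
  have hee : Real.exp (ε * dist o y) =
      Real.exp (ε / 2 * dist o y) * Real.exp (ε / 2 * dist o y) := by
    rw [← Real.exp_add]; ring_nf
  rw [hee]
  calc K * Real.exp (ε / 2 * dist o y) * dist o y
      ≤ K * Real.exp (ε / 2 * dist o y) * ((ε / 2)⁻¹ * Real.exp (ε / 2 * dist o y)) := by
        gcongr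
        exact le_inv_mul_exp_mul (half_pos hε) _
    _ = _ := by ring

end FakeDist

/-! ### Schottky sets -/

section Schottky

variable {X : Type*} [MetricSpace X]

theorem GeodesicLine.not_sameForwardEndpoint_reverse (ℓ : GeodesicLine X) :
    ¬ ℓ.SameForwardEndpoint ℓ.reverse := by
  rintro ⟨C, h⟩
  have h0 := h (|C| + 1) (by positivity)
  change dist (ℓ.toFun (|C| + 1)) (ℓ.toFun (-(|C| + 1))) ≤ C at h0
  rw [dist_comm, ℓ.dist_toFun (by linarith [abs_nonneg C])] at h0
  linarith [le_abs_self C, abs_nonneg C]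

theorem GeodesicLine.SameForwardEndpoint.symm {ℓ m : GeodesicLine X}
    (h : ℓ.SameForwardEndpoint m) : m.SameForwardEndpoint ℓ := by
  obtain ⟨C, hC⟩ := h
  exact ⟨C, fun t ht => by rw [dist_comm]; exact hC t ht⟩

/-- The Gromov products of points on rays with distinct endpoints are bounded. -/
theorem IsGromovHyperbolic.exists_gromovProduct_le {δ : ℝ} (hδ : IsGromovHyperbolic X δ)
    {ℓ m : GeodesicLine X} (h : ¬ ℓ.SameForwardEndpoint m) (o : X) :
    ∃ C, ∀ s t : ℝ, 0 ≤ s → 0 ≤ t → gromovProduct o (ℓ.toFun s) (m.toFun t) ≤ C := by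
  by_contra! hcon
  apply h
  have : Nonempty X := ⟨o⟩
  have hδ0 := hδ.nonneg
  set r := dist o (ℓ.toFun 0)
  set r' := dist o (m.toFun 0)
  have hr : 0 ≤ r := dist_nonneg
  have hr' : 0 ≤ r' := dist_nonneg
  refine ⟨3 * r + 3 * r' + 4 * δ, fun u hu => ?_⟩
  -- So large a product forces `s, t ≥ u`. Hyperbolicity along the chain `ℓ u, ℓ s, m t, m u` then
  -- bounds `(ℓ u | m u)_o` below by `u - r - r' - 2δ`, so that `ℓ u` and `m u` are close.
  obtain ⟨s, t, hs, ht, hst⟩ := hcon (u + r + r')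
  have bounds : ∀ (k : GeodesicLine X) (v : ℝ), 0 ≤ v →
      v - dist o (k.toFun 0) ≤ dist o (k.toFun v) ∧
      dist o (k.toFun v) ≤ v + dist o (k.toFun 0) := by
    intro k v hv
    have h1 := dist_triangle o (k.toFun 0) (k.toFun v)
    have h2 := dist_triangle_left (k.toFun 0) (k.toFun v) o
    rw [k.dist_toFun hv] at h1 h2
    constructor <;> linarith
  have hus : u ≤ s := by
    have := gromovProduct_le_left o (ℓ.toFun s) (m.toFun t)
    have := (bounds ℓ s hs).2
    linarith
  have hut : u ≤ t := by
    have := gromovProduct_le_right o (ℓ.toFun s) (m.toFun t)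
    have := (bounds m t ht).2
    linarith
  have g1 : u - r ≤ gromovProduct o (ℓ.toFun u) (ℓ.toFun s) := by
    unfold gromovProduct
    rw [ℓ.dist_toFun hus]
    linarith [(bounds ℓ u hu).1, (bounds ℓ s hs).1]
  have g2 : u - r' ≤ gromovProduct o (m.toFun t) (m.toFun u) := by
    unfold gromovProduct
    rw [dist_comm (m.toFun t), m.dist_toFun hut]
    linarith [(bounds m u hu).1, (bounds m t ht).1]
  have g3 := hδ o (ℓ.toFun u) (ℓ.toFun s) (m.toFun t)
  have g3' : u - r ≤ min (gromovProduct o (ℓ.toFun u) (ℓ.toFun s))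
      (gromovProduct o (ℓ.toFun s) (m.toFun t)) := le_min g1 (by linarith)
  have g4 := hδ o (ℓ.toFun u) (m.toFun t) (m.toFun u)
  have g4' : u - r - r' - δ ≤ min (gromovProduct o (ℓ.toFun u) (m.toFun t))
      (gromovProduct o (m.toFun t) (m.toFun u)) := le_min (by linarith) (by linarith)
  rw [dist_eq_gromovProduct o]
  linarith [(bounds ℓ u hu).2, (bounds m u hu).2]

theorem GeodesicLine.pow_smul_toFun {Γ : Type*} [Group Γ] [MulAction Γ X]
    {g : Γ} {ℓ : GeodesicLine X} {τ : ℝ}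
    (h : ∀ t, g • ℓ.toFun t = ℓ.toFun (t + τ)) (n : ℕ) (t : ℝ) :
    g ^ n • ℓ.toFun t = ℓ.toFun (t + n * τ) := by
  induction n generalizing t with
  | zero => simp
  | succ n ih =>
    rw [pow_succ', mul_smul, ih, h]
    push_cast
    ring_nf

theorem IsLoxodromicWithAxis.pow {Γ : Type*} [Group Γ] [MulAction Γ X]
    {g : Γ} {ℓ : GeodesicLine X} (h : IsLoxodromicWithAxis g ℓ)
    {n : ℕ} (hn : n ≠ 0) : IsLoxodromicWithAxis (g ^ n) ℓ := by
  obtain ⟨τ, hτ, H⟩ := h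
  exact ⟨n * τ, by positivity, GeodesicLine.pow_smul_toFun H n⟩

variable {Γ : Type*} [Group Γ] [MulAction Γ X] [IsIsometricSMul Γ X]

/-- Random translation by one of four elements in general position makes all distances grow on
average. -/
theorem IsGromovHyperbolic.one_le_sum_of_schottky {δ : ℝ} (hδ : IsGromovHyperbolic X δ) (o : X)
    (s : Fin 4 → Γ) {C R : ℝ}
    (h₁ : ∀ i j, i ≠ j → gromovProduct o (s i • o) (s j • o) ≤ C)
    (h₂ : ∀ i j, i ≠ j → gromovProduct o ((s i)⁻¹ • o) ((s j)⁻¹ • o) ≤ C)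
    (hR : ∀ i, |dist o (s i • o) - R| ≤ C) (hRC : 10 * C + 12 * δ + 1 ≤ R) (z y : X) :
    1 ≤ ∑ i, (dist z (s i • y) - dist z o) := by
  have : Nonempty X := ⟨o⟩
  have hδ0 := hδ.nonneg
  have hC0 : 0 ≤ C := (gromovProduct_nonneg _ _ _).trans (h₁ 0 1 (by decide))
  -- Two points `a i`, `a j` that both had a large product with `x` would have a large product with
  -- each other, so at most one index is bad.
  have sep : ∀ (x : X) (a : Fin 4 → X), (∀ i j, i ≠ j → gromovProduct o (a i) (a j) ≤ C) →
      ∃ i₀, ∀ i, i ≠ i₀ → gromovProduct o x (a i) ≤ C + δ := by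
    intro x a ha
    by_cases hex : ∃ i₀, C + δ < gromovProduct o x (a i₀)
    · obtain ⟨i₀, hi₀⟩ := hex
      refine ⟨i₀, fun i hi => ?_⟩
      by_contra! hlt
      have h3 := hδ o (a i) x (a i₀)
      rw [gromovProduct_comm o (a i) x] at h3
      have := lt_min hlt hi₀
      linarith [ha i i₀ hi]
    · push Not at hex
      exact ⟨0, fun i _ => hex i⟩
  obtain ⟨i₀, hi₀⟩ := sep z _ h₁
  obtain ⟨i₁, hi₁⟩ := sep y _ h₂
  set K := 5 * C + 6 * δ with hK
  -- A good index gains about `R + d(o, y)`. The index `i₀`, for which `s i • o` may point towards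
  -- `z`, can lose both terms; the index `i₁`, for which `y` may point towards `(s i)⁻¹ • o`, can
  -- lose the second. With four elements the two losses of `2 d(o, y)` cancel the four gains, and
  -- `2R - 4K` remains.
  have lower : ∀ i, R + dist o y - K - (if i = i₀ then 2 * R + 2 * dist o y else 0) -
      (if i = i₁ then 2 * dist o y else 0) ≤ dist z (s i • y) - dist z o := by
    intro i
    have hRi := abs_le.1 (hR i)
    have hy : dist (s i • o) (s i • y) = dist o y := dist_smul _ _ _
    have hy0 : 0 ≤ dist o y := dist_nonneg
    have t1 := dist_triangle_right z (s i • o) (s i • y)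
    rw [hy] at t1
    have t2 := dist_triangle_right z o (s i • o)
    by_cases c0 : i = i₀
    · rw [if_pos c0]
      split_ifs <;> linarith
    rw [if_neg c0]
    have k0 := hi₀ i c0
    have k0' : dist z o + dist o (s i • o) - 2 * (C + δ) ≤ dist z (s i • o) := by
      unfold gromovProduct at k0
      rw [dist_comm o z] at k0
      linarith
    by_cases c1 : i = i₁
    · rw [if_pos c1]
      linarith
    rw [if_neg c1]
    have k1 := hi₁ i c1
    -- Since `s i • o` does not point towards `z`, the point `(s i)⁻¹ • z` lies far in the direction
    -- of `(s i)⁻¹ • o`, which `y` avoids.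
    have e1 : gromovProduct o ((s i)⁻¹ • z) ((s i)⁻¹ • o) =
        dist o (s i • o) - gromovProduct o z (s i • o) := by
      rw [← gromovProduct_smul (s i)]
      simp only [smul_inv_smul, gromovProduct]
      rw [dist_comm (s i • o) z, dist_comm (s i • o) o, dist_comm z o]
      ring
    have k2 : gromovProduct o ((s i)⁻¹ • z) y ≤ C + 2 * δ := by
      by_contra! hlt
      have h3 := hδ o y ((s i)⁻¹ • z) ((s i)⁻¹ • o)
      have h4 : C + 2 * δ < min (gromovProduct o y ((s i)⁻¹ • z))
          (gromovProduct o ((s i)⁻¹ • z) ((s i)⁻¹ • o)) := by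
        refine lt_min (by rwa [gromovProduct_comm]) ?_
        rw [e1]; linarith
      linarith
    have e2 : dist z (s i • y) = dist ((s i)⁻¹ • z) y := by
      rw [← dist_smul (s i) _ y, smul_inv_smul]
    have e3 : dist z (s i • o) = dist ((s i)⁻¹ • z) o := by
      rw [← dist_smul (s i) _ o, smul_inv_smul]
    rw [e2, dist_eq_gromovProduct o ((s i)⁻¹ • z) y, dist_comm o ((s i)⁻¹ • z), ← e3]
    linarith
  calc (1 : ℝ) ≤ 2 * R - 4 * K := by rw [hK]; linarith
    _ = ∑ i : Fin 4, (R + dist o y - K - (if i = i₀ then 2 * R + 2 * dist o y else 0) -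
      (if i = i₁ then 2 * dist o y else 0)) := by
        rw [Finset.sum_sub_distrib, Finset.sum_sub_distrib, Finset.sum_ite_eq',
          Finset.sum_ite_eq']
        simp
        ring
    _ ≤ _ := Finset.sum_le_sum fun i _ => lower i

/-- Suitable powers of two independent loxodromic isometries, and their inverses, make all
distances grow on average. -/
theorem IsGromovHyperbolic.exists_pow_schottky {δ : ℝ} (hδ : IsGromovHyperbolic X δ) (o : X)
    {g h : Γ} {ℓ m : GeodesicLine X} (hg : IsLoxodromicWithAxis g ℓ)
    (hh : IsLoxodromicWithAxis h m) (h₁ : ¬ ℓ.SameForwardEndpoint m)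
    (h₂ : ¬ ℓ.SameForwardEndpoint m.reverse) (h₃ : ¬ ℓ.reverse.SameForwardEndpoint m)
    (h₄ : ¬ ℓ.reverse.SameForwardEndpoint m.reverse) :
    ∃ k l : ℕ, ∀ z y : X,
      1 ≤ ∑ i, (dist z ((![g ^ k, (g ^ k)⁻¹, h ^ l, (h ^ l)⁻¹] : Fin 4 → Γ) i • y) -
        dist z o) := by
  obtain ⟨τ, hτ, Hg⟩ := hg
  obtain ⟨σ, hσ, Hh⟩ := hh
  have powg := GeodesicLine.pow_smul_toFun Hg
  have powh := GeodesicLine.pow_smul_toFun Hh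
  -- The rays towards the four fixed points; the `i`-th Schottky element moves `o` to within `r` of
  -- the `i`-th ray.
  let ray : Fin 4 → GeodesicLine X := ![ℓ, ℓ.reverse, m, m.reverse]
  have hray : ∀ i j, i ≠ j → ¬ (ray i).SameForwardEndpoint (ray j) := by
    have n1 := ℓ.not_sameForwardEndpoint_reverse
    have n2 := m.not_sameForwardEndpoint_reverse
    intro i j hij
    fin_cases i <;> fin_cases j <;> first
      | exact absurd rfl hij
      | assumption
      | (intro hs; have hs' := hs.symm; revert hs'; assumption)
  have hex : ∀ i j, ∃ C, i ≠ j → ∀ s t : ℝ, 0 ≤ s → 0 ≤ t →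
      gromovProduct o ((ray i).toFun s) ((ray j).toFun t) ≤ C := by
    intro i j
    by_cases hij : i = j
    · exact ⟨0, fun hne => absurd hij hne⟩
    · obtain ⟨C, hC⟩ := hδ.exists_gromovProduct_le (hray i j hij) o
      exact ⟨C, fun _ => hC⟩
  choose C₀ hC₀ using hex
  set C₁ := ∑ i, ∑ j, |C₀ i j|
  have hC₁ : ∀ i j, C₀ i j ≤ C₁ := by
    intro i j
    calc C₀ i j ≤ |C₀ i j| := le_abs_self _
      _ ≤ ∑ j, |C₀ i j| := Finset.single_le_sum (f := fun j => |C₀ i j|)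
          (fun _ _ => abs_nonneg _) (Finset.mem_univ j)
      _ ≤ C₁ := Finset.single_le_sum (f := fun i => ∑ j, |C₀ i j|)
          (fun _ _ => Finset.sum_nonneg fun _ _ => abs_nonneg _) (Finset.mem_univ i)
  set r := dist o (ℓ.toFun 0) + dist o (m.toFun 0)
  have hr1 : dist o (ℓ.toFun 0) ≤ r := le_add_of_nonneg_right dist_nonneg
  have hr2 : dist o (m.toFun 0) ≤ r := le_add_of_nonneg_left dist_nonneg
  have hr0 : 0 ≤ r := dist_nonneg.trans hr1
  have hC10 : 0 ≤ C₁ := Finset.sum_nonneg fun _ _ => Finset.sum_nonneg fun _ _ => abs_nonneg _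
  -- The term `2 * r` pays for replacing `s i • o` by a point of the ray, and `σ` for the mismatch
  -- between `k * τ` and `l * σ`.
  set C := C₁ + 2 * r + σ
  obtain ⟨k, hk⟩ := exists_nat_ge ((10 * C + 12 * δ + 1) / τ)
  rw [div_le_iff₀ hτ] at hk
  -- The powers are balanced: all four displacements must be close to a common `R = k * τ`.
  set l := ⌊k * τ / σ⌋₊
  have hl1 : l * σ ≤ k * τ := by
    rw [← le_div_iff₀ hσ]; exact Nat.floor_le (by positivity)
  have hl2 : k * τ - σ ≤ l * σ := by
    have := Nat.lt_floor_add_one (k * τ / σ)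
    rw [div_lt_iff₀ hσ] at this
    linarith
  refine ⟨k, l, ?_⟩
  let T : Fin 4 → ℝ := ![k * τ, k * τ, l * σ, l * σ]
  set s : Fin 4 → Γ := ![g ^ k, (g ^ k)⁻¹, h ^ l, (h ^ l)⁻¹] with hs
  have hT0 : ∀ i, 0 ≤ T i := by
    intro i
    fin_cases i <;> simp [T] <;> positivity
  have hT1 : ∀ i, |T i - k * τ| ≤ σ := by
    intro i
    rw [abs_le]
    fin_cases i <;> simp [T] <;> first | linarith | (constructor <;> linarith)
  have hclose : ∀ i, dist (s i • o) ((ray i).toFun (T i)) ≤ r := by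
    have aux : ∀ (γ : Γ) (x y : X), γ • x = y → dist o x ≤ r → dist (γ • o) y ≤ r := by
      rintro γ x _ rfl hx
      rwa [dist_smul]
    intro i
    fin_cases i
    · exact aux _ (ℓ.toFun 0) _ (by simp [s, T, powg, ray]) hr1
    · refine aux _ (ℓ.toFun 0) _ ?_ hr1
      simp [s, T, ray, inv_smul_eq_iff, powg, GeodesicLine.reverse]
    · exact aux _ (m.toFun 0) _ (by simp [s, T, powh, ray]) hr2
    · refine aux _ (m.toFun 0) _ ?_ hr2
      simp [s, T, ray, inv_smul_eq_iff, powh, GeodesicLine.reverse]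
  have hprod : ∀ i j, i ≠ j → gromovProduct o (s i • o) (s j • o) ≤ C := by
    intro i j hij
    have b := hC₀ i j hij (T i) (T j) (hT0 i) (hT0 j)
    have c := hC₁ i j
    have t1 := dist_triangle_right o (s i • o) ((ray i).toFun (T i))
    have t2 := dist_triangle_right o (s j • o) ((ray j).toFun (T j))
    have t3 := dist_triangle4_right ((ray i).toFun (T i)) ((ray j).toFun (T j))
      (s i • o) (s j • o)
    have t4 := hclose i
    have t5 := hclose j
    have t6 := dist_triangle o ((ray i).toFun (T i)) (s i • o)
    have t7 := dist_triangle o ((ray j).toFun (T j)) (s j • o)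
    rw [dist_comm ((ray i).toFun (T i)) (s i • o)] at t3 t6
    rw [dist_comm ((ray j).toFun (T j)) (s j • o)] at t3 t7
    unfold gromovProduct at b ⊢
    linarith
  -- The family is closed under inverses, so the condition on inverses is the one just proved.
  let inv : Fin 4 → Fin 4 := ![1, 0, 3, 2]
  have hinv : ∀ i, (s i)⁻¹ = s (inv i) := by
    intro i
    fin_cases i <;> simp [s, inv]
  have hinvinj : ∀ i j, i ≠ j → inv i ≠ inv j := by decide
  refine hδ.one_le_sum_of_schottky o s (C := C) (R := k * τ) hprod (fun i j hij => ?_)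
    (fun i => ?_) hk
  · rw [hinv, hinv]
    exact hprod _ _ (hinvinj i j hij)
  · have d1 : dist ((ray i).toFun 0) ((ray i).toFun (T i)) = T i := by
      rw [(ray i).dist_toFun (hT0 i), sub_zero]
    have d2 : dist o ((ray i).toFun 0) ≤ r := by
      fin_cases i <;> simp [ray, GeodesicLine.reverse, hr1, hr2]
    have d3 := hclose i
    have d4 := abs_le.1 (hT1 i)
    have t1 := dist_triangle4 o ((ray i).toFun 0) ((ray i).toFun (T i)) (s i • o)
    have t2 := dist_triangle4 ((ray i).toFun 0) o (s i • o) ((ray i).toFun (T i))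
    rw [dist_comm ((ray i).toFun (T i))] at t1
    rw [dist_comm ((ray i).toFun 0) o] at t2
    rw [abs_le]
    constructor <;> linarith [d4.1, d4.2]

end Schottky

/-! ### Convolution powers and exponential moments -/

section ConvPow

variable {Γ : Type*} [Group Γ] [MeasurableSpace Γ]

/-- The `n`-th convolution power of a measure on a group. -/
noncomputable def convPow (μ : Measure Γ) : ℕ → Measure Γ
  | 0 => Measure.dirac 1
  | n + 1 => Measure.mconv (convPow μ n) μ

instance [MeasurableMul₂ Γ] (μ : Measure Γ) [IsProbabilityMeasure μ] (n : ℕ) :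
    IsProbabilityMeasure (convPow μ n) := by
  induction n with
  | zero => exact Measure.dirac.isProbabilityMeasure
  | succ n ih => exact Measure.probabilitymeasure_of_probabilitymeasures_mconv _ _

variable [MeasurableMul₂ Γ] (μ : Measure Γ) [IsProbabilityMeasure μ]

theorem convPow_one : convPow μ 1 = μ := Measure.dirac_one_mconv μ

theorem convPow_add (n m : ℕ) :
    convPow μ (n + m) = Measure.mconv (convPow μ n) (convPow μ m) := by
  induction m with
  | zero => exact (Measure.mconv_dirac_one _).symm
  | succ m ih => rw [← add_assoc, convPow, ih, Measure.mconv_assoc, ← convPow]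

theorem convPow_convPow (n m : ℕ) : convPow (convPow μ n) m = convPow μ (n * m) := by
  induction m with
  | zero => rfl
  | succ m ih => rw [convPow, ih, Nat.mul_succ, convPow_add]

theorem convPow_add_apply_ne_zero [MeasurableSingletonClass Γ] {n m : ℕ} {a b : Γ}
    (ha : convPow μ n {a} ≠ 0) (hb : convPow μ m {b} ≠ 0) : convPow μ (n + m) {a * b} ≠ 0 := by
  rw [convPow_add, Measure.mconv, Measure.map_apply measurable_mul (measurableSet_singleton _)]
  have hsub : ({a} : Set Γ) ×ˢ ({b} : Set Γ) ⊆ (fun x : Γ × Γ => x.1 * x.2) ⁻¹' {a * b} := by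
    rintro ⟨x, y⟩ ⟨rfl, rfl⟩
    rfl
  refine (lt_of_lt_of_le ?_ (measure_mono hsub)).ne'
  rw [Measure.prod_prod]
  exact pos_iff_ne_zero.2 (mul_ne_zero ha hb)

theorem convPow_mul_apply_ne_zero [MeasurableSingletonClass Γ] {n : ℕ} {a : Γ}
    (ha : convPow μ n {a} ≠ 0) (k : ℕ) : convPow μ (n * k) {a ^ k} ≠ 0 := by
  induction k with
  | zero => simp [convPow]
  | succ k ih =>
    rw [Nat.mul_succ, pow_succ]
    exact convPow_add_apply_ne_zero μ ih ha

theorem IsGenerating.exists_convPow_ne_zero [MeasurableSingletonClass Γ] {μ : Measure Γ}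
    [IsProbabilityMeasure μ] (h : IsGenerating μ) (g : Γ) :
    ∃ n, convPow μ n {g} ≠ 0 := by
  have hg : g ∈ Subsemigroup.closure {g : Γ | μ {g} ≠ 0} := by rw [h]; trivial
  induction hg using Subsemigroup.closure_induction with
  | mem x hx => exact ⟨1, by rwa [convPow_one]⟩
  | mul x y _ _ hx hy =>
    obtain ⟨n, hn⟩ := hx
    obtain ⟨m, hm⟩ := hy
    exact ⟨n + m, convPow_add_apply_ne_zero μ hn hm⟩

end ConvPow

section ExpMoment

theorem integrable_of_abs_le_exp {X Γ : Type*} [MetricSpace X] [SMul Γ X] [Countable Γ]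
    [MeasurableSpace Γ] [MeasurableSingletonClass Γ] {o : X} {t : ℝ} {ν : Measure Γ}
    (hν : Integrable (fun g : Γ => Real.exp (t * dist o (g • o))) ν) {f : Γ → ℝ} (K : ℝ)
    (hf : ∀ g, |f g| ≤ K * Real.exp (t * dist o (g • o))) : Integrable f ν :=
  (hν.const_mul K).mono' (measurable_of_countable f).aestronglyMeasurable
    (Eventually.of_forall fun g => hf g)

theorem one_le_integral_exp {X Γ : Type*} [MetricSpace X] [SMul Γ X] [MeasurableSpace Γ]
    {o : X} {t : ℝ} (ht : 0 ≤ t)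
    {μ : Measure Γ} [IsProbabilityMeasure μ]
    (hμ : Integrable (fun g : Γ => Real.exp (t * dist o (g • o))) μ) :
    1 ≤ ∫ g, Real.exp (t * dist o (g • o)) ∂μ := by
  have := integral_mono (integrable_const (1 : ℝ)) hμ fun g => Real.one_le_exp
    (by positivity : 0 ≤ t * dist o (g • o))
  simpa using this

variable {X Γ : Type*} [MetricSpace X] [Group Γ] [MulAction Γ X] [IsIsometricSMul Γ X]

theorem dist_mul_smul_le (o : X) (g h : Γ) :
    dist o ((g * h) • o) ≤ dist o (g • o) + dist o (h • o) := by
  have := dist_triangle o (g • o) ((g * h) • o)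
  rwa [mul_smul, dist_smul, ← mul_smul] at this

variable [Countable Γ] [MeasurableSpace Γ] [MeasurableSingletonClass Γ]

omit [IsIsometricSMul Γ X] in
theorem integrable_exp_of_le {o : X} {s t : ℝ} (hst : s ≤ t) {ν : Measure Γ}
    (hν : Integrable (fun g : Γ => Real.exp (t * dist o (g • o))) ν) :
    Integrable (fun g : Γ => Real.exp (s * dist o (g • o))) ν :=
  integrable_of_abs_le_exp hν 1 fun g => by
    rw [Real.abs_exp, one_mul]
    gcongr

/-- By the triangle inequality `g ↦ exp(t d(o, g o))` is submultiplicative. -/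
theorem integrable_exp_mconv [MeasurableMul₂ Γ] {o : X} {t : ℝ} (ht : 0 ≤ t) {ν ν' : Measure Γ}
    [SFinite ν] [SFinite ν']
    (hν : Integrable (fun g : Γ => Real.exp (t * dist o (g • o))) ν)
    (hν' : Integrable (fun g : Γ => Real.exp (t * dist o (g • o))) ν') :
    Integrable (fun g : Γ => Real.exp (t * dist o (g • o))) (Measure.mconv ν ν') ∧
    ∫ g, Real.exp (t * dist o (g • o)) ∂(Measure.mconv ν ν') ≤
      (∫ g, Real.exp (t * dist o (g • o)) ∂ν) * ∫ g, Real.exp (t * dist o (g • o)) ∂ν' := by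
  have hle : ∀ a b : Γ, Real.exp (t * dist o ((a * b) • o)) ≤
      Real.exp (t * dist o (a • o)) * Real.exp (t * dist o (b • o)) := fun a b => by
    rw [← Real.exp_add, ← mul_add]
    gcongr
    exact dist_mul_smul_le o a b
  have hprod := hν.mul_prod hν'
  have hint : Integrable (fun x : Γ × Γ => Real.exp (t * dist o ((x.1 * x.2) • o)))
      (ν.prod ν') := by
    refine hprod.mono' (measurable_of_countable _).aestronglyMeasurable
      (Eventually.of_forall fun x => ?_)
    rw [Real.norm_eq_abs, Real.abs_exp]
    exact hle _ _
  constructor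
  · rw [Measure.mconv, integrable_map_measure
      (measurable_of_countable _).aestronglyMeasurable measurable_mul.aemeasurable]
    exact hint
  · rw [Measure.mconv, integral_map measurable_mul.aemeasurable
      (measurable_of_countable _).aestronglyMeasurable, ← integral_prod_mul]
    exact integral_mono hint hprod fun x => hle _ _

theorem integrable_exp_convPow [MeasurableMul₂ Γ] {o : X} {t : ℝ} (ht : 0 ≤ t) {μ : Measure Γ}
    [IsProbabilityMeasure μ]
    (hμ : Integrable (fun g : Γ => Real.exp (t * dist o (g • o))) μ) (n : ℕ) :
    Integrable (fun g : Γ => Real.exp (t * dist o (g • o))) (convPow μ n) ∧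
    ∫ g, Real.exp (t * dist o (g • o)) ∂(convPow μ n) ≤
      (∫ g, Real.exp (t * dist o (g • o)) ∂μ) ^ n := by
  induction n with
  | zero => exact ⟨integrable_dirac (by simp), by simp [convPow]⟩
  | succ n ih =>
    obtain ⟨h1, h2⟩ := integrable_exp_mconv ht ih.1 hμ
    refine ⟨h1, h2.trans ?_⟩
    rw [pow_succ]
    gcongr
    exact ih.2

end ExpMoment

/-! ### Drift of a random walk -/

/-- A finite measure splits off a multiple of the counting measure of a finite family
of its atoms. -/
theorem exists_integral_eq_add_sum {ι Γ : Type*} [Fintype ι] [Nonempty ι] [MeasurableSpace Γ]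
    [MeasurableSingletonClass Γ] (κ : Measure Γ)
    [IsFiniteMeasure κ] (s : ι → Γ) (hs : ∀ i, κ {s i} ≠ 0) :
    ∃ (ν : Measure Γ) (α : ℝ), 0 < α ∧ ν ≤ κ ∧
      ∀ f : Γ → ℝ, Integrable f κ → ∫ g, f g ∂κ = ∫ g, f g ∂ν + α * ∑ i, f (s i) := by
  obtain ⟨i₀, hi₀⟩ := Finite.exists_min fun i => κ {s i}
  -- The division by the cardinality allows for repetitions in the family: even if all the points
  -- coincide, the total mass is at most that of the lightest atom.
  set c : ENNReal := κ {s i₀} / Fintype.card ι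
  have hc0 : c ≠ 0 := ENNReal.div_ne_zero.2 ⟨hs i₀, ENNReal.natCast_ne_top _⟩
  have hct : c ≠ ⊤ := ENNReal.div_ne_top (measure_ne_top _ _) (by simp)
  set D : Measure Γ := ∑ i, c • Measure.dirac (s i) with hD
  have hle : D ≤ κ := by
    refine Measure.le_iff.2 fun A hA => ?_
    rw [hD, Measure.finsetSum_apply]
    by_cases hex : ∃ j, s j ∈ A
    · obtain ⟨j, hj⟩ := hex
      calc ∑ i, (c • Measure.dirac (s i)) A ≤ ∑ _i : ι, c := by
            refine Finset.sum_le_sum fun i _ => ?_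
            rw [Measure.smul_apply, smul_eq_mul]
            exact mul_le_of_le_one_right' prob_le_one
        _ = κ {s i₀} := by
            rw [Finset.sum_const, nsmul_eq_mul, Finset.card_univ]
            exact ENNReal.mul_div_cancel (by simp) (by simp)
        _ ≤ κ {s j} := hi₀ j
        _ ≤ κ A := measure_mono (by simpa using hj)
    · push Not at hex
      rw [Finset.sum_eq_zero]
      · exact zero_le
      · intro i _
        rw [Measure.smul_apply, Measure.dirac_apply' _ hA, Set.indicator_of_notMem (hex i),
          smul_zero]
  have hDfin : IsFiniteMeasure D := ⟨(hle Set.univ).trans_lt (measure_lt_top _ _)⟩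
  have hadd := Measure.sub_add_cancel_of_le hle
  refine ⟨κ - D, c.toReal, ENNReal.toReal_pos hc0 hct, Measure.sub_le, fun f hf => ?_⟩
  conv_lhs => rw [← hadd]
  rw [integral_add_measure (hf.mono_measure Measure.sub_le) (hf.mono_measure hle), hD,
    integral_finsetSum_measure fun i _ => (integrable_dirac (by simp)).smul_measure hct]
  simp [integral_smul_measure, Finset.mul_sum]

section Drift

variable {X Γ : Type*} [MetricSpace X] [Group Γ] [MulAction Γ X] [IsIsometricSMul Γ X]

/-- The growth of the distance to `z` when `o` is moved to `g • o`. -/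
noncomputable def distGain (o z : X) (g : Γ) : ℝ := dist z (g • o) - dist z o

/-- A cocycle relation: the later steps see the direction `g⁻¹ • z`. This is why bounds uniform in
`z` can be iterated along the walk. -/
theorem distGain_mul (o z : X) (g h : Γ) :
    distGain o z (g * h) = distGain o z g + distGain o (g⁻¹ • z) h := by
  unfold distGain
  rw [← dist_smul g (g⁻¹ • z) (h • o), ← dist_smul g (g⁻¹ • z) o, smul_inv_smul, mul_smul]
  ring

omit [IsIsometricSMul Γ X] in
theorem abs_distGain_le (o z : X) (g : Γ) : |distGain o z g| ≤ dist o (g • o) := by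
  rw [distGain, abs_le]
  constructor <;> linarith [dist_triangle z o (g • o), dist_triangle_right z o (g • o)]

variable [Countable Γ] [MeasurableSpace Γ] [MeasurableSingletonClass Γ]

theorem integrable_distGain_mul {o : X} {t : ℝ} (ht : 0 < t) {ν : Measure Γ}
    (hν : Integrable (fun g : Γ => Real.exp (t * dist o (g • o))) ν) (z : X) (w : Γ) :
    Integrable (fun g : Γ => distGain o z (w * g)) ν := by
  refine integrable_of_abs_le_exp hν (dist o (w • o) + t⁻¹) fun g => ?_
  refine (abs_distGain_le o z _).trans ((dist_mul_smul_le o w g).trans ?_)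
  have h1 := le_inv_mul_exp_mul ht (dist o (g • o))
  have h2 : 1 ≤ Real.exp (t * dist o (g • o)) := Real.one_le_exp (by positivity)
  rw [add_mul]
  exact add_le_add (le_mul_of_one_le_right dist_nonneg h2) h1

theorem integrable_distGain {o : X} {t : ℝ} (ht : 0 < t) {ν : Measure Γ}
    (hν : Integrable (fun g : Γ => Real.exp (t * dist o (g • o))) ν) (z : X) :
    Integrable (fun g : Γ => distGain o z g) ν := by
  simpa using integrable_distGain_mul ht hν z 1

variable [MeasurableMul₂ Γ]

/-- If left multiplication by the elements of a Schottky family, which is charged by `κ`, makes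
distances grow, then the random walk driven by `κ` has positive drift in every direction. -/
theorem exists_le_integral_distGain {o : X} {t : ℝ} (ht : 0 < t) (κ : Measure Γ)
    [IsProbabilityMeasure κ] (hκ : Integrable (fun g : Γ => Real.exp (t * dist o (g • o))) κ)
    (s : Fin 4 → Γ) (hs : ∀ i, κ {s i} ≠ 0)
    (hgain : ∀ z y : X, 1 ≤ ∑ i, (dist z (s i • y) - dist z o)) :
    ∃ α > 0, ∃ K : ℝ, ∀ (n : ℕ) (z : X), α * n - K ≤ ∫ g, distGain o z g ∂(convPow κ n) := by
  obtain ⟨ν, α, hα, hνκ, hdec⟩ := exists_integral_eq_add_sum κ s hs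
  have hνfin : IsFiniteMeasure ν := ⟨(hνκ Set.univ).trans_lt (measure_lt_top _ _)⟩
  have hmass : ν.real Set.univ = 1 - 4 * α := by
    have := hdec (fun _ => 1) (integrable_const _)
    simp at this
    linarith
  have hconv := fun n => (integrable_exp_convPow ht.le hκ n).1
  have hgain' : ∀ (z : X) (w : Γ), 1 ≤ ∑ i, distGain o z (s i * w) := fun z w => by
    simpa [distGain, mul_smul] using hgain z (w • o)
  -- Conditioning on the next step after a prefix `w`: it is drawn from `ν`, or it is one of the
  -- four Schottky elements, each with mass `α`.
  have hstep : ∀ (n : ℕ) (z : X) (w : Γ),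
      Integrable (fun g => ∫ x, distGain o z (w * g * x) ∂(convPow κ n)) κ ∧
      ∫ g, distGain o z (w * g) ∂(convPow κ (n + 1)) =
        ∫ g, ∫ x, distGain o z (w * g * x) ∂(convPow κ n) ∂ν +
          α * ∑ i, ∫ x, distGain o z (w * s i * x) ∂(convPow κ n) := by
    intro n z w
    have h0 : Integrable (fun g => ∫ x, distGain o z (w * g * x) ∂(convPow κ n)) κ := by
      have h1 : ∀ g, ∫ x, distGain o z (w * g * x) ∂(convPow κ n) = distGain o z (w * g) +
          ∫ x, distGain o ((w * g)⁻¹ • z) x ∂(convPow κ n) := fun g => by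
        simp_rw [distGain_mul o z (w * g)]
        rw [integral_add (integrable_const _) (integrable_distGain ht (hconv n) _)]
        simp
      simp_rw [h1]
      refine (integrable_distGain_mul ht hκ z w).add ?_
      refine Integrable.mono' (integrable_const (∫ x, dist o (x • o) ∂(convPow κ n)))
        (measurable_of_countable _).aestronglyMeasurable (Eventually.of_forall fun g => ?_)
      refine norm_integral_le_of_norm_le ?_ (Eventually.of_forall fun x => abs_distGain_le o _ x)
      refine integrable_of_abs_le_exp (hconv n) t⁻¹ fun x => ?_
      rw [abs_of_nonneg dist_nonneg]
      exact le_inv_mul_exp_mul ht _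
    refine ⟨h0, ?_⟩
    have hi := integrable_distGain_mul ht (hconv (n + 1)) z w
    rw [add_comm n 1, convPow_add, convPow_one] at hi ⊢
    rw [integral_mconv hi]
    simp_rw [← mul_assoc]
    exact hdec _ h0
  -- Here `s i` is the latest Schottky step, summed over its four values, and `w` the product of the
  -- steps since. A step from `ν` only lengthens `w`. A new Schottky step `s j` secures the gain of
  -- `s i * w`, whose sum over `i` is at least `1`, and starts a new sum over `j`; since its mass is
  -- `4α`, the bound grows by `4α` per step.
  have hB : ∀ (n : ℕ) (z : X) (w : Γ),
      1 + 4 * α * n ≤ ∑ i, ∫ x, distGain o z (s i * w * x) ∂(convPow κ n) := by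
    intro n
    induction n with
    | zero =>
      intro z w
      simpa [convPow] using hgain' z w
    | succ n ih =>
      intro z w
      simp_rw [(hstep n z _).2]
      rw [Finset.sum_add_distrib, ← integral_finsetSum _ fun i _ =>
        (hstep n z _).1.mono_measure hνκ, ← Finset.mul_sum]
      have h1 : (1 - 4 * α) * (1 + 4 * α * n) ≤
          ∫ g, ∑ i, ∫ x, distGain o z (s i * w * g * x) ∂(convPow κ n) ∂ν := by
        have := integral_mono (μ := ν) (integrable_const (1 + 4 * α * n))
          (integrable_finsetSum Finset.univ fun i _ =>
            (hstep n z (s i * w)).1.mono_measure hνκ) fun g => by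
            have := ih z (w * g)
            simpa [mul_assoc] using this
        rw [integral_const, hmass, smul_eq_mul] at this
        exact this
      have h2 : ∀ i, 4 * distGain o z (s i * w) + (1 + 4 * α * n) ≤
          ∑ j, ∫ x, distGain o z (s i * w * s j * x) ∂(convPow κ n) := by
        intro i
        have h3 : ∀ j, ∫ x, distGain o z (s i * w * s j * x) ∂(convPow κ n) =
            distGain o z (s i * w) +
              ∫ x, distGain o ((s i * w)⁻¹ • z) (s j * x) ∂(convPow κ n) := fun j => by
          simp_rw [mul_assoc (s i * w), distGain_mul o z (s i * w)]
          rw [integral_add (integrable_const _) (integrable_distGain_mul ht (hconv n) _ _)]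
          simp
        simp_rw [h3]
        rw [Finset.sum_add_distrib]
        have := ih ((s i * w)⁻¹ • z) 1
        simp only [mul_one] at this
        simpa using this
      have h4 := Finset.sum_le_sum fun i (_ : i ∈ Finset.univ) => h2 i
      rw [Finset.sum_add_distrib, ← Finset.mul_sum] at h4
      simp only [Finset.sum_const, Finset.card_univ, Fintype.card_fin, nsmul_eq_mul] at h4
      have h5 := mul_le_mul_of_nonneg_left h4 hα.le
      have h6 := mul_le_mul_of_nonneg_left (hgain' z w) hα.le
      push_cast at h5 ⊢
      linarith
  set L := ∫ g, dist o (g • o) ∂ν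
  -- A first step from `ν` may lose up to `L` in total; the recursion closes when the Schottky mass
  -- `4α` times `K` equals `L`.
  refine ⟨α, hα, L / (4 * α), fun n => ?_⟩
  have hL : 4 * α * (L / (4 * α)) = L := by field_simp
  have hL0 : 0 ≤ L := integral_nonneg fun _ => dist_nonneg
  set K := L / (4 * α)
  induction n with
  | zero =>
    intro z
    have : 0 ≤ K := by positivity
    simpa [convPow, distGain] using this
  | succ n ih =>
    intro z
    have h0 := hstep n z 1
    simp only [one_mul] at h0
    rw [h0.2]
    have h1 := hB n z 1
    simp only [mul_one] at h1
    have hdist : Integrable (fun g : Γ => dist o (g • o)) ν := by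
      refine integrable_of_abs_le_exp (hκ.mono_measure hνκ) t⁻¹ fun x => ?_
      rw [abs_of_nonneg dist_nonneg]
      exact le_inv_mul_exp_mul ht _
    have h2 := integral_mono (μ := ν) (f := fun g => (α * n - K) - dist o (g • o))
      ((integrable_const _).sub hdist) (h0.1.mono_measure hνκ) fun g => by
        change (α * n - K) - dist o (g • o) ≤ ∫ x, distGain o z (g * x) ∂(convPow κ n)
        simp_rw [distGain_mul o z g]
        rw [integral_add (integrable_const _) (integrable_distGain ht (hconv n) _)]
        have := ih (g⁻¹ • z)
        have := (abs_le.1 (abs_distGain_le o z g)).1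
        simp
        linarith
    rw [integral_sub (integrable_const _) hdist, integral_const, hmass, smul_eq_mul] at h2
    have h3 := mul_le_mul_of_nonneg_left h1 hα.le
    push_cast
    linarith

end Drift

/-! ### Uniform exponential moments of Gromov products -/

/-- A second-order Taylor bound valid on the whole line, suited to unbounded gains. -/
theorem Real.exp_le_one_add_add_sq_mul_exp_abs (x : ℝ) :
    Real.exp x ≤ 1 + x + x ^ 2 * Real.exp |x| := by
  have h1 : 1 ≤ Real.exp |x| := Real.one_le_exp (abs_nonneg x)
  have h2 : x ^ 2 ≤ x ^ 2 * Real.exp |x| := le_mul_of_one_le_right (sq_nonneg x) h1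
  rcases le_or_gt |x| 1 with h | h
  · have := (abs_le.1 (Real.abs_exp_sub_one_sub_id_le h)).2
    linarith
  · rcases lt_abs.1 h with h | h
    · rw [abs_of_pos (by linarith)]
      have h3 : 1 ≤ x ^ 2 := by nlinarith
      have := mul_le_mul_of_nonneg_right h3 (Real.exp_pos x).le
      linarith
    · have h3 : Real.exp x ≤ 1 := Real.exp_le_one_iff.2 (by linarith)
      nlinarith

section GromovMoment

variable {X Γ : Type*} [MetricSpace X] [Group Γ] [MulAction Γ X] [IsIsometricSMul Γ X]

/-- How a Gromov product changes along a walk. -/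
theorem IsGromovHyperbolic.exp_gromovProduct_le {δ : ℝ} (hδ : IsGromovHyperbolic X δ) (o z : X)
    {ε : ℝ} (hε : 0 ≤ ε) (a b : Γ) :
    Real.exp (ε * gromovProduct o z ((a * b) • o)) ≤
      Real.exp (ε * δ) * (Real.exp (ε * dist o (a • o)) +
        Real.exp (-ε * distGain o z a) * Real.exp (ε * gromovProduct o (a⁻¹ • z) (b • o))) := by
  have : Nonempty X := ⟨o⟩
  have hδ0 := hδ.nonneg
  have e1 : gromovProduct o (a⁻¹ • z) (b • o) = gromovProduct (a • o) z ((a * b) • o) := by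
    rw [← gromovProduct_smul a, smul_inv_smul, mul_smul]
  rw [e1, ← Real.exp_add]
  set y := (a * b) • o
  -- If `(z | y)_o` exceeds `d(o, a o) + δ`, hyperbolicity gives `(a o | y)_o ≤ (a o | z)_o + δ`.
  -- This says that `d(o, ·) - d(a o, ·)` is at `y` at most `2δ` larger than at `z`, so moving the
  -- base point from `o` to `a o` changes the product by at most `δ - distGain o z a`.
  have key : gromovProduct o z y ≤ dist o (a • o) + δ ∨
      gromovProduct o z y ≤ δ - distGain o z a + gromovProduct (a • o) z y := by
    by_contra! hcon
    obtain ⟨h1, h2⟩ := hcon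
    have h3 := gromovProduct_le_right o z (a • o)
    have h4 := hδ o (a • o) y z
    rw [gromovProduct_comm o y z] at h4
    rw [gromovProduct_comm o z (a • o)] at h3
    have h5 : gromovProduct o (a • o) y ≤ gromovProduct o (a • o) z + δ := by
      by_contra! h6
      have h7 : gromovProduct o (a • o) z + δ <
          min (gromovProduct o (a • o) y) (gromovProduct o z y) := lt_min h6 (by linarith)
      linarith
    unfold distGain at h2
    unfold gromovProduct at h2 h5
    rw [dist_comm (a • o) z, dist_comm z o] at h2
    rw [dist_comm (a • o) z] at h5
    linarith
  rcases key with h | h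
  · calc Real.exp (ε * gromovProduct o z y) ≤ Real.exp (ε * (dist o (a • o) + δ)) := by gcongr
      _ = Real.exp (ε * δ) * Real.exp (ε * dist o (a • o)) := by rw [← Real.exp_add]; ring_nf
      _ ≤ _ := by
        gcongr
        exact le_add_of_nonneg_right (Real.exp_pos _).le
  · calc Real.exp (ε * gromovProduct o z y)
        ≤ Real.exp (ε * (δ - distGain o z a + gromovProduct (a • o) z y)) := by gcongr
      _ = Real.exp (ε * δ) *
          Real.exp (-ε * distGain o z a + ε * gromovProduct (a • o) z y) := by
          rw [← Real.exp_add]; ring_nf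
      _ ≤ _ := by
        gcongr
        exact le_add_of_nonneg_left (Real.exp_pos _).le

variable [Countable Γ] [MeasurableSpace Γ] [MeasurableSingletonClass Γ]

omit [IsIsometricSMul Γ X] in
theorem integrable_exp_distGain {o : X} {ε t : ℝ} (hε : 0 ≤ ε) (hεt : ε ≤ t) {ν : Measure Γ}
    (hν : Integrable (fun g : Γ => Real.exp (t * dist o (g • o))) ν) (z : X) :
    Integrable (fun g : Γ => Real.exp (-ε * distGain o z g)) ν := by
  refine integrable_of_abs_le_exp (integrable_exp_of_le hεt hν) 1 fun g => ?_
  rw [Real.abs_exp, one_mul, Real.exp_le_exp]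
  have := (abs_le.1 (abs_distGain_le o z g)).1
  nlinarith

/-- To first order `E exp(-ε · gain)` is `1 - ε E[gain] ≤ 1 - ε`, and the exponential moment bounds
the remainder by `C ε²`, uniformly in `z`. -/
theorem exists_integral_exp_distGain_le {o : X} {t : ℝ} (ht : 0 < t) (κ : Measure Γ)
    [IsProbabilityMeasure κ] (hκ : Integrable (fun g : Γ => Real.exp (t * dist o (g • o))) κ)
    (hgain : ∀ z : X, 1 ≤ ∫ g, distGain o z g ∂κ) :
    ∃ ε > 0, ε ≤ t ∧ ∃ ρ < 1, ∀ z : X, ∫ g, Real.exp (-ε * distGain o z g) ∂κ ≤ ρ := by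
  set E := ∫ g, Real.exp (t * dist o (g • o)) ∂κ
  have hE : 1 ≤ E := one_le_integral_exp ht.le hκ
  -- The square of the gain is bounded through `d ≤ (t/4)⁻¹ exp(t d/4)`; this uses half of the
  -- exponent `t`, and `ε ≤ t/2` leaves the other half for `exp |ε · gain|`.
  set C := ((t / 4)⁻¹) ^ 2 * E with hC
  have hC0 : 0 < C := by positivity
  set ε := min (t / 2) (1 / (2 * C))
  have hε : 0 < ε := lt_min (by positivity) (by positivity)
  have hεt : ε ≤ t / 2 := min_le_left _ _
  have hεC : ε * C ≤ 1 / 2 := by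
    calc ε * C ≤ 1 / (2 * C) * C := by gcongr; exact min_le_right _ _
      _ = 1 / 2 := by field_simp
  refine ⟨ε, hε, by linarith, 1 - ε / 2, by linarith, fun z => ?_⟩
  have hbound : ∀ g : Γ, Real.exp (-ε * distGain o z g) ≤
      1 + -ε * distGain o z g + ε ^ 2 * ((t / 4)⁻¹) ^ 2 * Real.exp (t * dist o (g • o)) := by
    intro g
    refine (Real.exp_le_one_add_add_sq_mul_exp_abs _).trans ?_
    have habs := abs_distGain_le o z g
    set d := dist o (g • o)
    have hd : 0 ≤ d := dist_nonneg
    have h1 : Real.exp |-ε * distGain o z g| ≤ Real.exp (t / 2 * d) := by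
      rw [abs_mul, abs_neg, abs_of_pos hε]
      gcongr
    have h2 : (-ε * distGain o z g) ^ 2 ≤ ε ^ 2 * (((t / 4)⁻¹) ^ 2 * Real.exp (t / 2 * d)) := by
      have h3 : (distGain o z g) ^ 2 ≤ ((t / 4)⁻¹ * Real.exp (t / 4 * d)) ^ 2 := by
        refine sq_le_sq' ?_ ?_ <;>
          linarith [le_inv_mul_exp_mul (by linarith : 0 < t / 4) d, (abs_le.1 habs).1,
            (abs_le.1 habs).2]
      have h4 : Real.exp (t / 4 * d) ^ 2 = Real.exp (t / 2 * d) := by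
        rw [← Real.exp_nat_mul]; congr 1; push_cast; ring
      rw [mul_pow, h4] at h3
      rw [mul_pow, neg_sq]
      gcongr
    have h5 : Real.exp (t * d) = Real.exp (t / 2 * d) * Real.exp (t / 2 * d) := by
      rw [← Real.exp_add]; ring_nf
    have := mul_le_mul h2 h1 (Real.exp_pos _).le (by positivity)
    rw [h5]
    linarith
  have hi1 := integrable_distGain ht hκ z
  have hi2 : Integrable (fun g : Γ => 1 + -ε * distGain o z g) κ :=
    (integrable_const _).add (hi1.const_mul _)
  have := integral_mono (integrable_exp_distGain hε.le (by linarith : ε ≤ t) hκ z)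
    (hi2.add (hκ.const_mul (ε ^ 2 * ((t / 4)⁻¹) ^ 2))) hbound
  refine this.trans ?_
  simp only [Pi.add_apply]
  rw [integral_add hi2 (hκ.const_mul _), integral_add (integrable_const _) (hi1.const_mul _),
    integral_const_mul, integral_const_mul]
  have h6 : ε ^ 2 * ((t / 4)⁻¹) ^ 2 * E = ε * (ε * C) := by rw [hC]; ring
  have h7 := mul_le_mul_of_nonneg_left hεC hε.le
  have h8 := mul_le_mul_of_nonneg_left (hgain z) hε.le
  simp only [integral_const, probReal_univ, one_smul]
  change 1 + -ε * _ + ε ^ 2 * ((t / 4)⁻¹) ^ 2 * E ≤ _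
  rw [h6]
  linarith

omit [IsIsometricSMul Γ X] in
theorem integrable_exp_gromovProduct {o : X} {ε : ℝ} (hε : 0 ≤ ε) {ν : Measure Γ}
    (hν : Integrable (fun g : Γ => Real.exp (ε * dist o (g • o))) ν) (z : X) :
    Integrable (fun g : Γ => Real.exp (ε * gromovProduct o z (g • o))) ν := by
  refine integrable_of_abs_le_exp hν 1 fun g => ?_
  rw [Real.abs_exp, one_mul]
  gcongr
  exact gromovProduct_le_right _ _ _

variable [MeasurableMul₂ Γ]

/-- Given the earlier steps with product `a`, the last step contributes a factor at most `ρ` in the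
direction `a⁻¹ • z`, whatever this direction is. -/
theorem integral_exp_distGain_convPow_le {o : X} {ε : ℝ} (hε : 0 ≤ ε) (κ : Measure Γ)
    [IsProbabilityMeasure κ] (hκ : Integrable (fun g : Γ => Real.exp (ε * dist o (g • o))) κ)
    {ρ : ℝ} (hρ : ∀ z : X, ∫ g, Real.exp (-ε * distGain o z g) ∂κ ≤ ρ) (n : ℕ) (z : X) :
    ∫ g, Real.exp (-ε * distGain o z g) ∂(convPow κ n) ≤ ρ ^ n := by
  have hρ0 : 0 ≤ ρ := (integral_nonneg fun _ => (Real.exp_pos _).le).trans (hρ o)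
  induction n generalizing z with
  | zero => simp [convPow, distGain]
  | succ n ih =>
    have hi := integrable_exp_distGain hε le_rfl (integrable_exp_convPow hε hκ (n + 1)).1 z
    rw [convPow] at hi ⊢
    rw [integral_mconv hi]
    have h1 : ∀ a : Γ, ∫ b, Real.exp (-ε * distGain o z (a * b)) ∂κ ≤
        Real.exp (-ε * distGain o z a) * ρ := fun a => by
      simp_rw [distGain_mul o z a, mul_add, Real.exp_add]
      rw [integral_const_mul]
      gcongr
      exact hρ _
    have hj := integrable_exp_distGain hε le_rfl (integrable_exp_convPow hε hκ n).1 z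
    refine (integral_mono_of_nonneg (Eventually.of_forall fun a =>
      integral_nonneg fun _ => (Real.exp_pos _).le) (hj.mul_const ρ)
      (Eventually.of_forall h1)).trans ?_
    rw [integral_mul_const, pow_succ]
    gcongr
    exact ih z

/-- If some convolution power of `μ` contracts exponentials of the distance, then the exponential
moments of Gromov products of the random walk with a fixed point are uniformly bounded. -/
theorem exists_integral_exp_gromovProduct_le {δ : ℝ} (hδ : IsGromovHyperbolic X δ) {o : X}
    {ε : ℝ} (hε : 0 < ε) (μ : Measure Γ) [IsProbabilityMeasure μ]
    (hμ : Integrable (fun g : Γ => Real.exp (ε * dist o (g • o))) μ)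
    {N : ℕ} (hN : N ≠ 0) {ρ : ℝ} (hρ1 : ρ < 1)
    (hρ : ∀ z : X, ∫ g, Real.exp (-ε * distGain o z g) ∂(convPow μ N) ≤ ρ) :
    ∃ M : ℝ, ∀ (n : ℕ) (z : X),
      ∫ g, Real.exp (ε * gromovProduct o z (g • o)) ∂(convPow μ n) ≤ M := by
  have hconv := fun n => integrable_exp_convPow hε.le hμ n
  have hρ0 : 0 ≤ ρ := (integral_nonneg fun _ => (Real.exp_pos _).le).trans (hρ o)
  set A := Real.exp (ε * δ)
  have hA : 0 < A := Real.exp_pos _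
  have hA1 : 1 ≤ A := by
    have : Nonempty X := ⟨o⟩
    exact Real.one_le_exp (mul_nonneg hε.le hδ.nonneg)
  -- Each use of hyperbolicity costs the factor `A`. A block of `k = N (j + 1)` steps is long enough
  -- for the contraction to beat it by a factor of two.
  obtain ⟨j, hj⟩ := exists_pow_lt_of_lt_one (show 0 < 1 / (2 * A) by positivity) hρ1
  have hj0 : ρ ^ (j + 1) ≤ 1 / (2 * A) :=
    (pow_le_pow_of_le_one hρ0 hρ1.le j.le_succ).trans hj.le
  set k := N * (j + 1)
  have hk0 : 0 < k := Nat.mul_pos (Nat.pos_of_ne_zero hN) j.succ_pos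
  set E := ∫ g, Real.exp (ε * dist o (g • o)) ∂μ
  have hE : 1 ≤ E := one_le_integral_exp hε.le hμ
  -- The fixed point of the recursion `M = A (E ^ k + M / (2A))`.
  refine ⟨2 * A * E ^ k, fun n => ?_⟩
  have hEk : 0 < E ^ k := by positivity
  induction n using Nat.strong_induction_on with
  | _ n ih =>
    intro z
    rcases lt_or_ge n k with hnk | hnk
    · have h1 := integral_mono (integrable_exp_gromovProduct hε.le (hconv n).1 z) (hconv n).1
        fun g => Real.exp_le_exp.2
          (mul_le_mul_of_nonneg_left (gromovProduct_le_right o z (g • o)) hε.le)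
      refine h1.trans ((hconv n).2.trans ?_)
      have h2 : E ^ n ≤ E ^ k := pow_le_pow_right₀ hE hnk.le
      nlinarith
    · obtain ⟨m, rfl⟩ := Nat.exists_eq_add_of_le hnk
      have hi := integrable_exp_gromovProduct hε.le (hconv (k + m)).1 z
      rw [convPow_add] at hi ⊢
      rw [integral_mconv hi]
      set M := 2 * A * E ^ k
      have h1 : ∀ a : Γ, ∫ b, Real.exp (ε * gromovProduct o z ((a * b) • o)) ∂(convPow μ m) ≤
          A * (Real.exp (ε * dist o (a • o)) + Real.exp (-ε * distGain o z a) * M) := by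
        intro a
        have hi2 := integrable_exp_gromovProduct hε.le (hconv m).1 (a⁻¹ • z)
        have hi3 : Integrable (fun b : Γ => A * (Real.exp (ε * dist o (a • o)) +
            Real.exp (-ε * distGain o z a) *
              Real.exp (ε * gromovProduct o (a⁻¹ • z) (b • o)))) (convPow μ m) :=
          ((integrable_const _).add (hi2.const_mul _)).const_mul _
        refine (integral_mono_of_nonneg (Eventually.of_forall fun b => (Real.exp_pos _).le) hi3
          (Eventually.of_forall fun b => hδ.exp_gromovProduct_le o z hε.le a b)).trans ?_
        rw [integral_const_mul, integral_add (integrable_const _) (hi2.const_mul _),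
          integral_const_mul]
        have := ih m (by omega) (a⁻¹ • z)
        simp only [integral_const, probReal_univ, one_smul]
        gcongr
      have hi4 := integrable_exp_distGain hε.le le_rfl (hconv k).1 z
      refine (integral_mono_of_nonneg (Eventually.of_forall fun a =>
        integral_nonneg fun _ => (Real.exp_pos _).le)
        (((hconv k).1.add (hi4.mul_const M)).const_mul A) (Eventually.of_forall h1)).trans ?_
      simp only [Pi.add_apply]
      rw [integral_const_mul, integral_add (hconv k).1 (hi4.mul_const M), integral_mul_const]
      have h5 : ∫ g, Real.exp (-ε * distGain o z g) ∂(convPow μ k) ≤ 1 / (2 * A) := by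
        rw [← convPow_convPow]
        exact (integral_exp_distGain_convPow_le hε.le _ (hconv N).1 hρ (j + 1) z).trans hj0
      calc A * (∫ g, Real.exp (ε * dist o (g • o)) ∂(convPow μ k) +
            (∫ g, Real.exp (-ε * distGain o z g) ∂(convPow μ k)) * M)
          ≤ A * (E ^ k + 1 / (2 * A) * M) := by
            have := (hconv k).2
            gcongr
        _ = M := by
            simp only [M]
            field_simp
            ring

/-- The random walk generated by a nonelementary measure with an exponential moment on the
isometries of a hyperbolic space deviates from a fixed direction with uniform exponential
moments. -/
theorem IsNonelementaryAction.exists_integral_exp_gromovProduct_le {δ : ℝ}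
    (hδ : IsGromovHyperbolic X δ) (hΓ : IsNonelementaryAction Γ X) {o : X} {μ : Measure Γ}
    [IsProbabilityMeasure μ] (hgen : IsGenerating μ) (hmom : HasExponentialMoment μ o) :
    ∃ ε > 0, Integrable (fun g : Γ => Real.exp (ε * dist o (g • o))) μ ∧
      ∃ M : ℝ, ∀ (n : ℕ) (z : X),
        ∫ g, Real.exp (ε * gromovProduct o z (g • o)) ∂(convPow μ n) ≤ M := by
  obtain ⟨t, ht, hμ⟩ := hmom
  obtain ⟨g, h, ℓ, m, hg, hh, h₁, h₂, h₃, h₄⟩ := hΓ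
  obtain ⟨a, ha⟩ := hgen.exists_convPow_ne_zero g
  obtain ⟨b, hb⟩ := hgen.exists_convPow_ne_zero g⁻¹
  obtain ⟨c, hc⟩ := hgen.exists_convPow_ne_zero h
  obtain ⟨d, hd⟩ := hgen.exists_convPow_ne_zero h⁻¹
  -- The walk returns to `1` with positive probability in `a + b` steps. These returns serve as
  -- padding, so that elements reached at different times are charged by one and the same
  -- convolution power.
  have h1 : convPow μ (a + b) {1} ≠ 0 := by
    have := convPow_add_apply_ne_zero μ ha hb
    rwa [mul_inv_cancel] at this
  -- At time `0` the walk is at `1`, but `g` translates its axis.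
  have ha0 : a + b ≠ 0 := by
    intro hab
    obtain rfl : a = 0 := by omega
    have hg1 : g = 1 := by
      by_contra hne
      exact ha (by simp [convPow, Ne.symm hne])
    obtain ⟨τ, hτ, H⟩ := hg
    have h0 := H 0
    rw [hg1, one_smul] at h0
    have := ℓ.isometry.injective h0
    linarith
  set e := a + b
  -- With `g ^ e` and `h ^ e` all arrival times are multiples of `e`, so the remaining time can be
  -- filled by returns of length `e`.
  obtain ⟨k, l, hgain⟩ := hδ.exists_pow_schottky o (hg.pow ha0) (hh.pow ha0) h₁ h₂ h₃ h₄
  have pad : ∀ {n : ℕ} {x : Γ}, convPow μ n {x} ≠ 0 → ∀ q J : ℕ, n * q ≤ J →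
      convPow μ (e * J) {(x ^ e) ^ q} ≠ 0 := by
    intro n x hx q J hJ
    obtain ⟨r, rfl⟩ := Nat.exists_eq_add_of_le hJ
    have := convPow_add_apply_ne_zero μ (convPow_mul_apply_ne_zero μ hx (e * q))
      (convPow_mul_apply_ne_zero μ h1 r)
    rwa [one_pow, mul_one, pow_mul, show n * (e * q) + e * r = e * (n * q + r) by ring] at this
  set J := a * k + b * k + c * l + d * l
  set κ := convPow μ (e * J)
  have hs : ∀ i, κ {(![(g ^ e) ^ k, ((g ^ e) ^ k)⁻¹, (h ^ e) ^ l, ((h ^ e) ^ l)⁻¹] :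
      Fin 4 → Γ) i} ≠ 0 := by
    intro i
    fin_cases i
    · exact pad ha k J (by omega)
    · have := pad hb k J (by omega)
      simpa using this
    · exact pad hc l J (by omega)
    · have := pad hd l J (by omega)
      simpa using this
  have hκ := (integrable_exp_convPow ht.le hμ (e * J)).1
  obtain ⟨α, hα, K, hdrift⟩ := exists_le_integral_distGain ht κ hκ _ hs hgain
  obtain ⟨n, hn⟩ := exists_nat_ge ((1 + K) / α)
  rw [div_le_iff₀ hα] at hn
  set N := e * J * n
  have hdrift' : ∀ z : X, 1 ≤ ∫ g, distGain o z g ∂(convPow μ N) := fun z => by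
    rw [← convPow_convPow]
    linarith [hdrift n z]
  have hN : N ≠ 0 := by
    intro h0
    have := hdrift' o
    rw [h0] at this
    simp [convPow, distGain] at this
    linarith
  obtain ⟨ε, hε, hεt, ρ, hρ1, hρ⟩ :=
    exists_integral_exp_distGain_le ht _ (integrable_exp_convPow ht.le hμ N).1 hdrift'
  have hμε := integrable_exp_of_le hεt hμ
  exact ⟨ε, hε, hμε, _root_.exists_integral_exp_gromovProduct_le hδ hε μ hμε hN hρ1 hρ⟩

end GromovMoment

/-! ### A law of large numbers for almost additive processes -/

/-- Consecutive cubes have ratio tending to `1`, and the sum in `h₂` dominates the fourth power of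
every deviation between `k³` and `(k + 1)³`. -/
theorem tendsto_div_of_tendsto_cubes {y : ℕ → ℝ} {L : ℝ}
    (h₁ : Tendsto (fun k : ℕ => y (k ^ 3) / (k : ℝ) ^ 3) atTop (𝓝 L))
    (h₂ : Tendsto (fun k : ℕ => ∑ m ∈ Finset.range (7 * k ^ 2),
      (y (k ^ 3 + m) - y (k ^ 3)) ^ 4 / (k : ℝ) ^ 12) atTop (𝓝 0)) :
    Tendsto (fun n : ℕ => y n / (n : ℝ)) atTop (𝓝 L) := by
  have hex : ∀ n : ℕ, ∃ k, k ^ 3 ≤ n ∧ n < (k + 1) ^ 3 := by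
    intro n
    refine ⟨Nat.findGreatest (fun k => k ^ 3 ≤ n) n,
      Nat.findGreatest_spec (P := fun k => k ^ 3 ≤ n) (Nat.zero_le n) (by simp), ?_⟩
    by_contra! hcon
    have hle : Nat.findGreatest (fun k => k ^ 3 ≤ n) n + 1 ≤ n :=
      (Nat.le_self_pow (by norm_num) _).trans hcon
    have := Nat.le_findGreatest (P := fun k => k ^ 3 ≤ n) hle hcon
    omega
  choose r hr1 hr2 using hex
  have hr : Tendsto r atTop atTop := by
    refine tendsto_atTop.2 fun b => ?_
    filter_upwards [eventually_ge_atTop (b ^ 3)] with n hn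
    by_contra! hlt
    have : (r n + 1) ^ 3 ≤ b ^ 3 := Nat.pow_le_pow_left hlt 3
    have := hr2 n
    omega
  have hr0 : ∀ᶠ n in atTop, 1 ≤ r n := hr.eventually (eventually_ge_atTop 1)
  have hratio : Tendsto (fun n : ℕ => (r n : ℝ) ^ 3 / (n : ℝ)) atTop (𝓝 1) := by
    have h3 : Tendsto (fun k : ℕ => ((k : ℝ) / (k + 1)) ^ 3) atTop (𝓝 1) := by
      simpa using (tendsto_natCast_div_add_atTop (𝕜 := ℝ) 1).pow 3
    refine tendsto_of_tendsto_of_tendsto_of_le_of_le' (h3.comp hr) tendsto_const_nhds ?_ ?_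
    · filter_upwards [hr0] with n hn
      have h4 : (n : ℝ) ≤ ((r n : ℝ) + 1) ^ 3 := by exact_mod_cast (hr2 n).le
      have h5 : (0 : ℝ) < n := by
        have : 0 < r n ^ 3 := by positivity
        exact_mod_cast this.trans_le (hr1 n)
      rw [Function.comp_apply, div_pow]
      gcongr
    · filter_upwards with n
      exact div_le_one_of_le₀ (by exact_mod_cast hr1 n) (Nat.cast_nonneg n)
  have hgap : Tendsto (fun n : ℕ => (y n - y (r n ^ 3)) / (r n : ℝ) ^ 3) atTop (𝓝 0) := by
    have h4 : Tendsto (fun n : ℕ => ((y n - y (r n ^ 3)) / (r n : ℝ) ^ 3) ^ 4) atTop (𝓝 0) := by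
      refine tendsto_of_tendsto_of_tendsto_of_le_of_le' tendsto_const_nhds (h₂.comp hr)
        (Eventually.of_forall fun n => by positivity) ?_
      filter_upwards [hr0] with n hn
      obtain ⟨m, hm⟩ := Nat.exists_eq_add_of_le (hr1 n)
      -- The offset is at most `3k² + 3k`, which is less than `7k²` as `k ≥ 1`.
      have hm7 : m < 7 * r n ^ 2 := by
        have := hr2 n
        nlinarith
      have h5 := Finset.single_le_sum (f := fun m => (y (r n ^ 3 + m) - y (r n ^ 3)) ^ 4 /
        (r n : ℝ) ^ 12) (fun i _ => by positivity) (Finset.mem_range.2 hm7)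
      refine le_trans (le_of_eq ?_) h5
      rw [← hm, div_pow, ← pow_mul]
    have h6 := h4.abs
    rw [tendsto_zero_iff_abs_tendsto_zero]
    have h7 : Tendsto (fun x : ℝ => √(√x)) (𝓝 0) (𝓝 0) := by
      have : Continuous fun x : ℝ => √(√x) := by fun_prop
      simpa using this.tendsto 0
    refine (h7.comp h4).congr fun n => ?_
    rw [Function.comp_apply, show ((y n - y (r n ^ 3)) / (r n : ℝ) ^ 3) ^ 4 =
      (((y n - y (r n ^ 3)) / (r n : ℝ) ^ 3) ^ 2) ^ 2 by ring, Real.sqrt_sq (sq_nonneg _),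
      Real.sqrt_sq_eq_abs]
    rfl
  have hlim := ((h₁.comp hr).add hgap).mul hratio
  rw [add_zero, mul_one] at hlim
  refine hlim.congr' ?_
  filter_upwards [hr0] with n hn
  have h8 : (r n : ℝ) ≠ 0 := by
    have : r n ≠ 0 := by omega
    exact_mod_cast this
  simp only [Function.comp_apply]
  rw [← add_div, add_sub_cancel, div_mul_div_cancel₀ (pow_ne_zero 3 h8)]

section AlmostAdditive

variable {Ω : Type*} [MeasurableSpace Ω] {P : Measure Ω}

/-- By monotone convergence the series of the `f k` has finite integral, so it converges almost
everywhere and its terms tend to `0`. This combines Chebyshev's inequality and Borel–Cantelli. -/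
theorem ae_tendsto_zero_of_summable_integral {f : ℕ → Ω → ℝ} (hf0 : ∀ k ω, 0 ≤ f k ω)
    (hf : ∀ k, Integrable (f k) P) (hsum : Summable fun k => ∫ ω, f k ω ∂P) :
    ∀ᵐ ω ∂P, Tendsto (fun k => f k ω) atTop (𝓝 0) := by
  have h1 : ∫⁻ ω, ∑' k, ENNReal.ofReal (f k ω) ∂P ≠ ⊤ := by
    rw [lintegral_tsum fun k => (hf k).aestronglyMeasurable.aemeasurable.ennreal_ofReal]
    simp_rw [← ofReal_integral_eq_lintegral_ofReal (hf _) (Eventually.of_forall (hf0 _))]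
    rw [← ENNReal.ofReal_tsum_of_nonneg (fun k => integral_nonneg (hf0 k)) hsum]
    exact ENNReal.ofReal_ne_top
  have h2 := ae_lt_top' (AEMeasurable.tsum fun k =>
    (hf k).aestronglyMeasurable.aemeasurable.ennreal_ofReal) h1
  filter_upwards [h2] with ω hω
  have h3 := ENNReal.tendsto_cofinite_zero_of_tsum_ne_top hω.ne
  rw [Nat.cofinite_eq_atTop] at h3
  have h4 := (ENNReal.tendsto_toReal ENNReal.zero_ne_top).comp h3
  refine h4.congr fun k => ?_
  simp [ENNReal.toReal_ofReal (hf0 k ω)]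

/-- A process `Y n m`, thought of as the contribution of the steps `n, …, n + m - 1`, which is
stationary, independent and additive up to an error bounded in `L⁴`. -/
structure IsAlmostAdditive (Y : ℕ → ℕ → Ω → ℝ) (P : Measure Ω) (Q : ℝ) : Prop where
  zero : Y 0 0 = 0
  identDistrib : ∀ n m, ProbabilityTheory.IdentDistrib (Y n m) (Y 0 m) P P
  indep : ∀ n m, ProbabilityTheory.IndepFun (Y 0 n) (Y n m) P
  measurable : ∀ n m, Measurable (Y n m)
  integrable_one : Integrable (fun ω => Y 0 1 ω ^ 4) P
  integrable_defect : ∀ n m, Integrable (fun ω => (Y 0 (n + m) ω - Y 0 n ω - Y n m ω) ^ 4) P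
  integral_one : ∫ ω, Y 0 1 ω ^ 4 ∂P ≤ Q
  integral_defect : ∀ n m, ∫ ω, (Y 0 (n + m) ω - Y 0 n ω - Y n m ω) ^ 4 ∂P ≤ Q

theorem add_pow_four_le (a b : ℝ) : (a + b) ^ 4 ≤ 8 * a ^ 4 + 8 * b ^ 4 := by
  nlinarith [sq_nonneg (a ^ 2 - b ^ 2), sq_nonneg (a - b), sq_nonneg ((a - b) * (a + b)),
    sq_nonneg ((a - b) ^ 2), mul_nonneg (sq_nonneg (a - b)) (sq_nonneg (a + b)),
    mul_nonneg (sq_nonneg (a - b)) (add_nonneg (sq_nonneg a) (sq_nonneg b))]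

theorem sq_le_one_add_pow_four (a : ℝ) : a ^ 2 ≤ 1 + a ^ 4 := by
  nlinarith [sq_nonneg (a ^ 2 - 1)]

theorem abs_le_one_add_pow_four (a : ℝ) : |a| ≤ 1 + a ^ 4 := by
  have h1 := sq_abs a
  have h2 := sq_nonneg (|a| - 1)
  nlinarith [sq_nonneg (a ^ 2 - 1)]

variable [IsProbabilityMeasure P]

omit [IsProbabilityMeasure P] in
theorem integrable_pow_four_add {f g : Ω → ℝ} (hf : Measurable f) (hg : Measurable g)
    (hf4 : Integrable (fun ω => f ω ^ 4) P) (hg4 : Integrable (fun ω => g ω ^ 4) P) :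
    Integrable (fun ω => (f ω + g ω) ^ 4) P ∧
    ∫ ω, (f ω + g ω) ^ 4 ∂P ≤ 8 * ∫ ω, f ω ^ 4 ∂P + 8 * ∫ ω, g ω ^ 4 ∂P := by
  have h : Integrable (fun ω => 8 * f ω ^ 4 + 8 * g ω ^ 4) P :=
    (hf4.const_mul 8).add (hg4.const_mul 8)
  have hi : Integrable (fun ω => (f ω + g ω) ^ 4) P := by
    refine h.mono' ((hf.add hg).pow_const 4).aestronglyMeasurable (Eventually.of_forall fun ω => ?_)
    rw [Real.norm_of_nonneg (by positivity)]
    exact add_pow_four_le _ _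
  refine ⟨hi, (integral_mono hi h fun ω => add_pow_four_le _ _).trans_eq ?_⟩
  rw [integral_add (hf4.const_mul 8) (hg4.const_mul 8), integral_const_mul, integral_const_mul]

theorem memLp_two_of_integrable_pow_four {f : Ω → ℝ} (hf : Measurable f)
    (hf4 : Integrable (fun ω => f ω ^ 4) P) : MemLp f 2 P := by
  rw [memLp_two_iff_integrable_sq hf.aestronglyMeasurable]
  refine ((integrable_const (1 : ℝ)).add hf4).mono' (hf.pow_const 2).aestronglyMeasurable
    (Eventually.of_forall fun ω => ?_)
  rw [Real.norm_of_nonneg (sq_nonneg _)]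
  exact sq_le_one_add_pow_four _

/-- Nonnegativity of the variance of `θ f - g` bounds the covariance. A small `θ` makes `f` count
almost once, at the expense of the error term `g`. -/
theorem variance_add_le {f g : Ω → ℝ} (hf : MemLp f 2 P) (hg : MemLp g 2 P) {θ : ℝ} (hθ : 0 < θ) :
    ProbabilityTheory.variance (f + g) P ≤
      (1 + θ) * ProbabilityTheory.variance f P + (1 + θ⁻¹) * ProbabilityTheory.variance g P := by
  have h1 := ProbabilityTheory.variance_nonneg (fun ω => θ * f ω - g ω) P
  have h2 := ProbabilityTheory.variance_fun_sub (hf.const_mul θ) hg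
  rw [h2, ProbabilityTheory.variance_const_mul, ProbabilityTheory.covariance_const_mul_left] at h1
  rw [ProbabilityTheory.variance_add hf hg]
  have h3 : 2 * ProbabilityTheory.covariance f g P ≤
      θ * ProbabilityTheory.variance f P + θ⁻¹ * ProbabilityTheory.variance g P := by
    have := mul_nonneg (inv_nonneg.2 hθ.le) h1
    have e : θ⁻¹ * (θ ^ 2 * ProbabilityTheory.variance f P -
        2 * (θ * ProbabilityTheory.covariance f g P) + ProbabilityTheory.variance g P) =
        θ * ProbabilityTheory.variance f P - 2 * ProbabilityTheory.covariance f g P +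
          θ⁻¹ * ProbabilityTheory.variance g P := by
      field_simp
    linarith
  linarith

end AlmostAdditive

theorem sum_range_pow_four_le (a : ℕ → ℝ) (m : ℕ) :
    (∑ i ∈ Finset.range m, a i) ^ 4 ≤ (m : ℝ) ^ 3 * ∑ i ∈ Finset.range m, a i ^ 4 := by
  rcases Nat.eq_zero_or_pos m with rfl | hm
  · simp
  have h1 := pow_sum_div_card_le_sum_pow (s := Finset.range m) (f := fun i => |a i|)
    (fun i _ => abs_nonneg _) 3
  rw [Finset.card_range, div_le_iff₀ (by positivity)] at h1
  have h2 : ∀ x : ℝ, |x| ^ 4 = x ^ 4 := fun x => by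
    rw [← abs_pow, abs_of_nonneg (by positivity)]
  simp only [Nat.reduceAdd, h2] at h1
  have h3 := pow_le_pow_left₀ (abs_nonneg _) (Finset.abs_sum_le_sum_abs a (Finset.range m)) 4
  rw [h2] at h3
  linarith

theorem one_add_inv_pow_le (k : ℕ) : (1 + (k : ℝ)⁻¹) ^ k ≤ 3 := by
  rcases Nat.eq_zero_or_pos k with rfl | hk
  · norm_num
  have h1 : 1 + (k : ℝ)⁻¹ ≤ Real.exp (k : ℝ)⁻¹ := by
    linarith [Real.add_one_le_exp (k : ℝ)⁻¹]
  calc (1 + (k : ℝ)⁻¹) ^ k ≤ Real.exp (k : ℝ)⁻¹ ^ k := by gcongr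
    _ = Real.exp 1 := by
      rw [← Real.exp_nat_mul, mul_inv_cancel₀ (by positivity)]
    _ ≤ 3 := Real.exp_one_lt_d9.le.trans (by norm_num)

/-! ### Means, variances and fourth moments of almost additive processes -/

namespace IsAlmostAdditive

open ProbabilityTheory

variable {Ω : Type*} [MeasurableSpace Ω] {P : Measure Ω} [IsProbabilityMeasure P]
  {Y : ℕ → ℕ → Ω → ℝ} {Q : ℝ}

omit [IsProbabilityMeasure P] in
theorem nonneg (h : IsAlmostAdditive Y P Q) : 0 ≤ Q :=
  (integral_nonneg fun ω => by positivity).trans h.integral_one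

omit [IsProbabilityMeasure P] in
theorem integral_sub_pow_four_le (h : IsAlmostAdditive Y P Q) (n m : ℕ)
    (hi : Integrable (fun ω => Y n m ω ^ 4) P) :
    Integrable (fun ω => (Y 0 (n + m) ω - Y 0 n ω) ^ 4) P ∧
    ∫ ω, (Y 0 (n + m) ω - Y 0 n ω) ^ 4 ∂P ≤ 8 * ∫ ω, Y n m ω ^ 4 ∂P + 8 * Q := by
  have := integrable_pow_four_add (h.measurable n m)
    (((h.measurable 0 (n + m)).sub (h.measurable 0 n)).sub (h.measurable n m)) hi
    (h.integrable_defect n m)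
  have e : ∀ ω, Y n m ω + (Y 0 (n + m) - Y 0 n - Y n m) ω = Y 0 (n + m) ω - Y 0 n ω := fun ω => by
    simp only [Pi.sub_apply]; ring
  simp_rw [e] at this
  refine ⟨this.1, this.2.trans ?_⟩
  have := h.integral_defect n m
  simp only [Pi.sub_apply]
  linarith

omit [IsProbabilityMeasure P] in
-- `Y 0 m` telescopes into `m` increments, each a one-step block plus a defect with fourth moment at
-- most `16 Q`; the power mean inequality does the rest. No cancellation is sought.
theorem pow_four (h : IsAlmostAdditive Y P Q) (n m : ℕ) :
    Integrable (fun ω => Y n m ω ^ 4) P ∧ ∫ ω, Y n m ω ^ 4 ∂P ≤ 16 * Q * (m : ℝ) ^ 4 := by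
  have hident : ∀ n m, IdentDistrib (fun ω => Y n m ω ^ 4) (fun ω => Y 0 m ω ^ 4) P P :=
    fun n m => (h.identDistrib n m).comp (u := fun x => x ^ 4) (by fun_prop)
  have hone : ∀ i, Integrable (fun ω => Y i 1 ω ^ 4) P ∧ ∫ ω, Y i 1 ω ^ 4 ∂P ≤ Q := fun i =>
    ⟨(hident i 1).integrable_iff.2 h.integrable_one,
      (hident i 1).integral_eq.trans_le h.integral_one⟩
  have hincr := fun i => h.integral_sub_pow_four_le i 1 (hone i).1
  have hsum : ∀ ω, Y 0 m ω ^ 4 ≤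
      (m : ℝ) ^ 3 * ∑ i ∈ Finset.range m, (Y 0 (i + 1) ω - Y 0 i ω) ^ 4 := by
    intro ω
    have := sum_range_pow_four_le (fun i => Y 0 (i + 1) ω - Y 0 i ω) m
    rwa [Finset.sum_range_sub (fun i => Y 0 i ω), h.zero, Pi.zero_apply, sub_zero] at this
  have hi := (integrable_finsetSum (Finset.range m) fun i _ => (hincr i).1).const_mul ((m : ℝ) ^ 3)
  have hi0 : Integrable (fun ω => Y 0 m ω ^ 4) P := by
    refine hi.mono' ((h.measurable 0 m).pow_const 4).aestronglyMeasurable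
      (Eventually.of_forall fun ω => ?_)
    rw [Real.norm_of_nonneg (by positivity)]
    exact hsum ω
  refine ⟨(hident n m).integrable_iff.2 hi0, (hident n m).integral_eq.trans_le ?_⟩
  refine (integral_mono hi0 hi hsum).trans ?_
  rw [integral_const_mul, integral_finsetSum _ fun i _ => (hincr i).1]
  have h16 : ∀ i ∈ Finset.range m, ∫ ω, (Y 0 (i + 1) ω - Y 0 i ω) ^ 4 ∂P ≤ 16 * Q := fun i _ => by
    linarith [(hincr i).2, (hone i).2]
  calc (m : ℝ) ^ 3 * ∑ i ∈ Finset.range m, ∫ ω, (Y 0 (i + 1) ω - Y 0 i ω) ^ 4 ∂P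
      ≤ (m : ℝ) ^ 3 * ∑ i ∈ Finset.range m, 16 * Q := by
        gcongr with i hi
        exact h16 i hi
    _ = 16 * Q * (m : ℝ) ^ 4 := by
        rw [Finset.sum_const, Finset.card_range, nsmul_eq_mul]; ring

theorem memLp_two (h : IsAlmostAdditive Y P Q) (n m : ℕ) : MemLp (Y n m) 2 P :=
  memLp_two_of_integrable_pow_four (h.measurable n m) (h.pow_four n m).1

theorem integrable (h : IsAlmostAdditive Y P Q) (n m : ℕ) : Integrable (Y n m) P :=
  (h.memLp_two n m).integrable (by norm_num)

theorem memLp_two_defect (h : IsAlmostAdditive Y P Q) (n m : ℕ) :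
    MemLp (Y 0 (n + m) - Y 0 n - Y n m) 2 P :=
  ((h.memLp_two _ _).sub (h.memLp_two _ _)).sub (h.memLp_two _ _)

theorem variance_defect_le (h : IsAlmostAdditive Y P Q) (n m : ℕ) :
    variance (Y 0 (n + m) - Y 0 n - Y n m) P ≤ 1 + Q := by
  have hm := h.memLp_two_defect n m
  refine (variance_le_expectation_sq hm.aestronglyMeasurable).trans ?_
  refine (integral_mono hm.integrable_sq ((integrable_const (1 : ℝ)).add
    (h.integrable_defect n m)) fun ω => ?_).trans ?_
  · exact sq_le_one_add_pow_four _
  · simp only [Pi.add_apply]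
    rw [integral_add (integrable_const _) (h.integrable_defect n m)]
    simpa using h.integral_defect n m

theorem abs_integral_defect_le (h : IsAlmostAdditive Y P Q) (n m : ℕ) :
    |∫ ω, Y 0 (n + m) ω ∂P - ∫ ω, Y 0 n ω ∂P - ∫ ω, Y 0 m ω ∂P| ≤ 1 + Q := by
  rw [← (h.identDistrib n m).integral_eq, ← integral_sub (h.integrable _ _) (h.integrable _ _),
    ← integral_sub (f := fun ω => Y 0 (n + m) ω - Y 0 n ω)
      ((h.integrable _ _).sub (h.integrable _ _)) (h.integrable _ _)]
  refine (abs_integral_le_integral_abs).trans ?_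
  refine (integral_mono ((h.memLp_two_defect n m).integrable (by norm_num)).abs
    ((integrable_const (1 : ℝ)).add (h.integrable_defect n m)) fun ω => ?_).trans ?_
  · exact abs_le_one_add_pow_four _
  · simp only [Pi.add_apply]
    rw [integral_add (integrable_const _) (h.integrable_defect n m)]
    simpa using h.integral_defect n m

theorem abs_integral_le (h : IsAlmostAdditive Y P Q) (n : ℕ) :
    |∫ ω, Y 0 n ω ∂P| ≤ (1 + 16 * Q) * n := by
  rcases Nat.eq_zero_or_pos n with rfl | hn
  · simp [h.zero]
  have hn' : (0 : ℝ) < n := by exact_mod_cast hn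
  -- Rescaling by `n` before comparing with the fourth power turns the bound of order `n⁴` into a
  -- linear one.
  have hpt : ∀ ω, |Y 0 n ω| ≤ n + ((n : ℝ) ^ 3)⁻¹ * Y 0 n ω ^ 4 := fun ω => by
    have h1 := mul_le_mul_of_nonneg_left (abs_le_one_add_pow_four (Y 0 n ω / n)) hn'.le
    rw [abs_div, abs_of_pos hn', mul_div_cancel₀ _ hn'.ne'] at h1
    refine h1.trans_eq ?_
    field_simp
  refine (abs_integral_le_integral_abs).trans ((integral_mono (h.integrable 0 n).abs
    ((integrable_const (n : ℝ)).add ((h.pow_four 0 n).1.const_mul _)) hpt).trans ?_)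
  simp only [Pi.add_apply]
  rw [integral_add (integrable_const _) ((h.pow_four 0 n).1.const_mul _), integral_const_mul]
  have h2 := mul_le_mul_of_nonneg_left (h.pow_four 0 n).2
    (inv_nonneg.2 (pow_nonneg hn'.le 3))
  have h3 : ((n : ℝ) ^ 3)⁻¹ * (16 * Q * (n : ℝ) ^ 4) = 16 * Q * n := by field_simp
  simp only [integral_const, probReal_univ, one_smul]
  linarith

/-- The means are additive up to `1 + Q`, so they become subadditive after adding this constant, and
Fekete's lemma applies. -/
theorem exists_tendsto_integral_div (h : IsAlmostAdditive Y P Q) :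
    ∃ L, Tendsto (fun n : ℕ => (∫ ω, Y 0 n ω ∂P) / n) atTop (𝓝 L) := by
  have hsub : Subadditive fun n => ∫ ω, Y 0 n ω ∂P + (1 + Q) := by
    intro n m
    have := (abs_le.1 (h.abs_integral_defect_le n m)).2
    linarith
  have hQ := h.nonneg
  have hbdd : BddBelow (Set.range fun n : ℕ => (∫ ω, Y 0 n ω ∂P + (1 + Q)) / n) := by
    refine ⟨-(1 + 16 * Q), ?_⟩
    rintro _ ⟨n, rfl⟩
    rcases Nat.eq_zero_or_pos n with rfl | hn
    · simp only [Nat.cast_zero, div_zero]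
      linarith
    have hn' : (0 : ℝ) < n := by exact_mod_cast hn
    simp only
    rw [le_div_iff₀ hn']
    linarith [(abs_le.1 (h.abs_integral_le n)).1]
  have h1 := hsub.tendsto_lim hbdd
  have h2 := h1.sub (tendsto_const_div_atTop_nhds_zero_nat (1 + Q))
  refine ⟨_, h2.congr fun n => ?_⟩
  rw [← sub_div, add_sub_cancel_right]

/-- This crude bound ignores independence and is only used for the short blocks of length `k`. -/
theorem variance_le (h : IsAlmostAdditive Y P Q) (m : ℕ) :
    variance (Y 0 m) P ≤ (1 + 16 * Q) * (m : ℝ) ^ 2 := by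
  rcases Nat.eq_zero_or_pos m with rfl | hm
  · simp [h.zero]
  have hm' : (0 : ℝ) < m := by exact_mod_cast hm
  refine (variance_le_expectation_sq (h.memLp_two 0 m).aestronglyMeasurable).trans ?_
  have hpt : ∀ ω, (Y 0 m ω) ^ 2 ≤ (m : ℝ) ^ 2 + ((m : ℝ) ^ 2)⁻¹ * Y 0 m ω ^ 4 := fun ω => by
    have h1 := mul_le_mul_of_nonneg_left (sq_le_one_add_pow_four (Y 0 m ω / m)) (sq_nonneg (m : ℝ))
    rw [div_pow, mul_div_cancel₀ _ (pow_ne_zero 2 hm'.ne')] at h1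
    refine h1.trans_eq ?_
    field_simp
  refine (integral_mono (h.memLp_two 0 m).integrable_sq ((integrable_const ((m : ℝ) ^ 2)).add
    ((h.pow_four 0 m).1.const_mul _)) hpt).trans ?_
  simp only [Pi.add_apply]
  rw [integral_add (integrable_const _) ((h.pow_four 0 m).1.const_mul _), integral_const_mul]
  have h2 := mul_le_mul_of_nonneg_left (h.pow_four 0 m).2
    (inv_nonneg.2 (pow_nonneg hm'.le 2))
  have h3 : ((m : ℝ) ^ 2)⁻¹ * (16 * Q * (m : ℝ) ^ 4) = 16 * Q * (m : ℝ) ^ 2 := by field_simp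
  simp only [integral_const, probReal_univ, one_smul]
  linarith

/-- Independence makes the variances of the two blocks add up exactly; the defect enters through
`θ`. -/
theorem variance_add_le (h : IsAlmostAdditive Y P Q) (n m : ℕ) {θ : ℝ} (hθ : 0 < θ) :
    variance (Y 0 (n + m)) P ≤
      (1 + θ) * (variance (Y 0 n) P + variance (Y 0 m) P) + (1 + θ⁻¹) * (1 + Q) := by
  have e : Y 0 (n + m) = (Y 0 n + Y n m) + (Y 0 (n + m) - Y 0 n - Y n m) := by
    ext ω; simp
  have h1 := _root_.variance_add_le ((h.memLp_two 0 n).add (h.memLp_two n m))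
    (h.memLp_two_defect n m) hθ
  rw [← e, (h.indep n m).variance_add (h.memLp_two 0 n) (h.memLp_two n m),
    (h.identDistrib n m).variance_eq] at h1
  refine h1.trans ?_
  have := h.variance_defect_le n m
  gcongr

theorem variance_mul_le (h : IsAlmostAdditive Y P Q) (k j : ℕ) {θ : ℝ} (hθ : 0 < θ) :
    variance (Y 0 (k * j)) P ≤
      (1 + θ) ^ j * (j * (variance (Y 0 k) P + (1 + θ⁻¹) * (1 + Q))) := by
  have hQ := h.nonneg
  set V := variance (Y 0 k) P
  have hV : 0 ≤ V := variance_nonneg _ _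
  induction j with
  | zero => simp [h.zero]
  | succ j ih =>
    refine (h.variance_add_le (k * j) k hθ).trans ?_
    set W := (1 + θ⁻¹) * (1 + Q)
    have hW : 0 ≤ W := by positivity
    have h1 : 1 ≤ (1 + θ) ^ j := one_le_pow₀ (by linarith)
    have h2 := mul_le_mul_of_nonneg_left ih (by linarith : 0 ≤ 1 + θ)
    have h3 : V + W ≤ (1 + θ) ^ j * (V + W) := le_mul_of_one_le_left (by positivity) h1
    have h4 := mul_le_mul_of_nonneg_left h3 (by linarith : 0 ≤ 1 + θ)
    have h5 : W ≤ (1 + θ) * W := le_mul_of_one_le_left hW (by linarith)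
    rw [pow_succ]
    push_cast
    linarith

/-- Take `k²` blocks of length `k` and `θ = k⁻²`. The accumulated factor `(1 + θ) ^ (k²)` is at most
`3`, while the variance of a block and the cost `1 + θ⁻¹` of a defect are both `O(k²)`; the total is
`O(k⁴)`. -/
theorem variance_cube_le (h : IsAlmostAdditive Y P Q) (k : ℕ) :
    variance (Y 0 (k ^ 3)) P ≤ 54 * (1 + Q) * (k : ℝ) ^ 4 := by
  have hQ := h.nonneg
  rcases Nat.eq_zero_or_pos k with rfl | hk
  · simp [h.zero]
  have hk' : (1 : ℝ) ≤ k := by exact_mod_cast hk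
  have h1 := h.variance_mul_le k (k ^ 2) (θ := ((k ^ 2 : ℕ) : ℝ)⁻¹) (by positivity)
  rw [← pow_succ', inv_inv] at h1
  refine h1.trans ?_
  have h2 := one_add_inv_pow_le (k ^ 2)
  have h3 := h.variance_le k
  have h4 : (1 : ℝ) ≤ (k : ℝ) ^ 2 := one_le_pow₀ hk'
  have h5 : variance (Y 0 k) P + (1 + ((k ^ 2 : ℕ) : ℝ)) * (1 + Q) ≤ 18 * (1 + Q) * (k : ℝ) ^ 2 := by
    push_cast
    nlinarith
  have h6 : (0 : ℝ) ≤ variance (Y 0 k) P + (1 + ((k ^ 2 : ℕ) : ℝ)) * (1 + Q) :=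
    add_nonneg (variance_nonneg _ _) (by positivity)
  calc _ ≤ 3 * (((k ^ 2 : ℕ) : ℝ) * (18 * (1 + Q) * (k : ℝ) ^ 2)) := by gcongr
    _ = 54 * (1 + Q) * (k : ℝ) ^ 4 := by push_cast; ring

/-- The law of large numbers for almost additive processes. -/
theorem exists_ae_tendsto_div (h : IsAlmostAdditive Y P Q) :
    ∃ L : ℝ, ∀ᵐ ω ∂P, Tendsto (fun n : ℕ => Y 0 n ω / (n : ℝ)) atTop (𝓝 L) := by
  obtain ⟨L, hL⟩ := h.exists_tendsto_integral_div
  have hQ := h.nonneg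
  refine ⟨L, ?_⟩
  have hsummable : Summable fun k : ℕ => ((k : ℝ) ^ 2)⁻¹ :=
    Real.summable_nat_pow_inv.2 (by norm_num)
  set ψ := fun n : ℕ => ∫ ω, Y 0 n ω ∂P
  -- The expectations are at most a constant times `k⁴ / k⁶ = k⁻²`, hence summable.
  have hcube : ∀ᵐ ω ∂P, Tendsto (fun k : ℕ =>
      (Y 0 (k ^ 3) ω - ψ (k ^ 3)) ^ 2 * ((k : ℝ) ^ 6)⁻¹) atTop (𝓝 0) := by
    have hi : ∀ k : ℕ, Integrable (fun ω => (Y 0 (k ^ 3) ω - ψ (k ^ 3)) ^ 2) P := fun k =>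
      ((h.memLp_two 0 (k ^ 3)).sub (memLp_const _)).integrable_sq
    refine ae_tendsto_zero_of_summable_integral (fun k ω => by positivity)
      (fun k => (hi k).mul_const _) ?_
    refine Summable.of_nonneg_of_le (fun k => integral_nonneg fun ω => by positivity) (fun k => ?_)
      (hsummable.mul_left (54 * (1 + Q)))
    rw [integral_mul_const, ← variance_eq_integral (h.measurable 0 _).aemeasurable]
    rcases Nat.eq_zero_or_pos k with rfl | hk
    · simp
    have hk' : (0 : ℝ) < k := by exact_mod_cast hk
    calc variance (Y 0 (k ^ 3)) P * ((k : ℝ) ^ 6)⁻¹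
        ≤ 54 * (1 + Q) * (k : ℝ) ^ 4 * ((k : ℝ) ^ 6)⁻¹ := by
          gcongr
          exact h.variance_cube_le k
      _ = 54 * (1 + Q) * ((k : ℝ) ^ 2)⁻¹ := by field_simp
  -- There are `7k²` terms with expectation `O(k⁸ / k¹²)`, hence again `O(k⁻²)` in total.
  have hgap : ∀ᵐ ω ∂P, Tendsto (fun k : ℕ => ∑ m ∈ Finset.range (7 * k ^ 2),
      (Y 0 (k ^ 3 + m) ω - Y 0 (k ^ 3) ω) ^ 4 / (k : ℝ) ^ 12) atTop (𝓝 0) := by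
    have hi := fun n m => h.integral_sub_pow_four_le n m (h.pow_four n m).1
    refine ae_tendsto_zero_of_summable_integral
      (fun k ω => Finset.sum_nonneg fun m _ => by positivity)
      (fun k => integrable_finsetSum _ fun m _ => (hi _ m).1.div_const _) ?_
    refine Summable.of_nonneg_of_le (fun k => integral_nonneg fun ω =>
      Finset.sum_nonneg fun m _ => by positivity) (fun k => ?_)
      (hsummable.mul_left (7 * (8 * (16 * Q * 7 ^ 4) + 8 * Q)))
    rw [integral_finsetSum _ fun m _ => (hi _ m).1.div_const _]
    rcases Nat.eq_zero_or_pos k with rfl | hk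
    · simp
    have hk' : (1 : ℝ) ≤ k := by exact_mod_cast hk
    have hk0 : (0 : ℝ) < k := by linarith
    have hterm : ∀ m ∈ Finset.range (7 * k ^ 2),
        ∫ ω, (Y 0 (k ^ 3 + m) ω - Y 0 (k ^ 3) ω) ^ 4 / (k : ℝ) ^ 12 ∂P ≤
          (8 * (16 * Q * 7 ^ 4) + 8 * Q) * (k : ℝ) ^ 8 / (k : ℝ) ^ 12 := by
      intro m hm
      rw [integral_div]
      have hm' : (m : ℝ) ≤ 7 * (k : ℝ) ^ 2 := by exact_mod_cast (Finset.mem_range.1 hm).le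
      have h1 : (m : ℝ) ^ 4 ≤ 7 ^ 4 * (k : ℝ) ^ 8 := by
        calc (m : ℝ) ^ 4 ≤ (7 * (k : ℝ) ^ 2) ^ 4 := by gcongr
          _ = 7 ^ 4 * (k : ℝ) ^ 8 := by ring
      have h2 : (1 : ℝ) ≤ (k : ℝ) ^ 8 := one_le_pow₀ hk'
      have h3 := mul_le_mul_of_nonneg_left h1 (by positivity : 0 ≤ 16 * Q)
      have h4 := mul_le_mul_of_nonneg_left h2 hQ
      gcongr
      linarith [(hi (k ^ 3) m).2, (h.pow_four (k ^ 3) m).2]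
    refine (Finset.sum_le_sum hterm).trans_eq ?_
    rw [Finset.sum_const, Finset.card_range, nsmul_eq_mul]
    push_cast
    field_simp
  filter_upwards [hcube, hgap] with ω h1 h2
  refine tendsto_div_of_tendsto_cubes (y := fun n => Y 0 n ω) ?_ h2
  have hcubes : Tendsto (fun k : ℕ => k ^ 3) atTop atTop := tendsto_pow_atTop (by norm_num)
  have h3 := hL.comp hcubes
  have h4 : Tendsto (fun k : ℕ => (Y 0 (k ^ 3) ω - ψ (k ^ 3)) / (k : ℝ) ^ 3) atTop (𝓝 0) := by
    rw [tendsto_zero_iff_abs_tendsto_zero]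
    have h5 : Tendsto (fun x : ℝ => √x) (𝓝 0) (𝓝 0) := by
      simpa using Real.continuous_sqrt.tendsto 0
    refine (h5.comp h1).congr fun k => ?_
    rw [Function.comp_apply, show (Y 0 (k ^ 3) ω - ψ (k ^ 3)) ^ 2 * ((k : ℝ) ^ 6)⁻¹ =
      ((Y 0 (k ^ 3) ω - ψ (k ^ 3)) / (k : ℝ) ^ 3) ^ 2 by rw [div_pow, ← pow_mul, div_eq_mul_inv],
      Real.sqrt_sq_eq_abs]
    rfl
  have h6 := h3.add h4
  rw [add_zero] at h6
  refine h6.congr fun k => ?_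
  simp only [Function.comp_apply, ψ]
  push_cast
  rw [← add_div, add_sub_cancel]

end IsAlmostAdditive

/-! ### The random walk -/

theorem walk_congr {Γ : Type*} [Group Γ] {g h : ℕ → Γ} {n : ℕ} (hgh : ∀ i < n, g i = h i) :
    walk g n = walk h n := by
  induction n with
  | zero => rfl
  | succ n ih =>
    rw [walk, walk, ih fun i hi => hgh i (by omega), hgh n (by omega)]

theorem walk_add {Γ : Type*} [Group Γ] (g : ℕ → Γ) (n m : ℕ) :
    walk g (n + m) = walk g n * walk (fun i => g (n + i)) m := by
  induction m with
  | zero => simp [walk]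
  | succ m ih => rw [← add_assoc, walk, walk, ih, mul_assoc]

section Walk

variable {Γ : Type*} [Group Γ] [MeasurableSpace Γ] [MeasurableMul₂ Γ]

theorem measurable_walk_shift (n m : ℕ) :
    Measurable fun g : ℕ → Γ => walk (fun i => g (n + i)) m := by
  induction m with
  | zero => exact measurable_const
  | succ m ih => exact ih.mul (measurable_pi_apply _)

theorem measurable_walk (n : ℕ) : Measurable fun g : ℕ → Γ => walk g n := by
  simpa using measurable_walk_shift (Γ := Γ) 0 n

variable (μ : Measure Γ) [IsProbabilityMeasure μ]

instance : IsProbabilityMeasure (incrementLaw μ) := by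
  unfold incrementLaw; infer_instance

/-- Disjoint blocks of a random walk are independent. -/
theorem indepFun_walk (n m : ℕ) :
    ProbabilityTheory.IndepFun (fun g : ℕ → Γ => walk g n)
      (fun g : ℕ → Γ => walk (fun i => g (n + i)) m) (incrementLaw μ) := by
  classical
  have hind : ProbabilityTheory.iIndepFun (fun i (g : ℕ → Γ) => g i) (incrementLaw μ) :=
    ProbabilityTheory.iIndepFun_infinitePi (X := fun _ x => x) fun _ => measurable_id
  have hST := hind.indepFun_finset (Finset.range n) (Finset.Ico n (n + m))
    (Finset.disjoint_left.2 fun i hi hi' => by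
      rw [Finset.mem_range] at hi
      rw [Finset.mem_Ico] at hi'
      omega) fun i => measurable_pi_apply i
  -- `walk` reads an infinite sequence. Extending a finite tuple by `1` exhibits each block as a
  -- function of finitely many increments.
  have hext : ∀ S : Finset ℕ, Measurable fun (x : S → Γ) (i : ℕ) =>
      if h : i ∈ S then x ⟨i, h⟩ else 1 := fun S => by
    refine measurable_pi_lambda _ fun i => ?_
    by_cases h : i ∈ S
    · simp only [dif_pos h]
      exact measurable_pi_apply _
    · simp only [dif_neg h]
      exact measurable_const
  have := hST.comp ((measurable_walk n).comp (hext _)) ((measurable_walk_shift n m).comp (hext _))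
  convert this using 1
  · ext g
    refine walk_congr fun i hi => ?_
    simp [hi]
  · ext g
    refine walk_congr fun i hi => ?_
    simp [hi]

theorem map_walk_shift (n m : ℕ) :
    (incrementLaw μ).map (fun g : ℕ → Γ => walk (fun i => g (n + i)) m) = convPow μ m := by
  have hzero : ∀ m, (incrementLaw μ).map (fun g : ℕ → Γ => walk g m) = convPow μ m := by
    intro m
    induction m with
    | zero =>
      change (incrementLaw μ).map (fun _ : ℕ → Γ => (1 : Γ)) = _
      rw [Measure.map_const, measure_univ, one_smul]
      rfl
    | succ m ih =>
      have h1 := indepFun_walk μ m 1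
      simp only [walk, one_mul, add_zero] at h1
      have h2 := h1.map_mul_eq_map_mconv_map (measurable_walk m) (measurable_pi_apply m)
      rw [ih, incrementLaw, Measure.infinitePi_map_eval] at h2
      exact h2
  have hshift : (incrementLaw μ).map (fun (g : ℕ → Γ) i => g (n + i)) = incrementLaw μ :=
    Measure.map_infinitePi_infinitePi_of_inj (P := fun _ => μ) (add_right_injective n)
  rw [← hzero m]
  conv_rhs => rw [← hshift]
  rw [Measure.map_map (measurable_walk m) (by fun_prop)]
  rfl

theorem map_walk (n : ℕ) :
    (incrementLaw μ).map (fun g : ℕ → Γ => walk g n) = convPow μ n := by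
  simpa using map_walk_shift μ 0 n

theorem map_walk_prod (n m : ℕ) :
    (incrementLaw μ).map (fun g : ℕ → Γ => (walk g n, walk (fun i => g (n + i)) m)) =
      (convPow μ n).prod (convPow μ m) := by
  have h := (ProbabilityTheory.indepFun_iff_map_prod_eq_prod_map_map
    (measurable_walk n).aemeasurable (measurable_walk_shift n m).aemeasurable).1
    (indepFun_walk μ n m)
  rw [h, map_walk, map_walk_shift]

/-- A function on a group which is additive up to an error with bounded fourth moments defines an
almost additive process along a random walk. -/
theorem isAlmostAdditive_walk [Countable Γ] [MeasurableSingletonClass Γ] {φ : Γ → ℝ} {Q : ℝ}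
    (h1 : φ 1 = 0) (hint : Integrable (fun g => φ g ^ 4) μ) (hle : ∫ g, φ g ^ 4 ∂μ ≤ Q)
    (hdefect : ∀ n m, Integrable (fun x : Γ × Γ => (φ (x.1 * x.2) - φ x.1 - φ x.2) ^ 4)
      ((convPow μ n).prod (convPow μ m)))
    (hdefect_le : ∀ n m, ∫ x : Γ × Γ, (φ (x.1 * x.2) - φ x.1 - φ x.2) ^ 4
      ∂((convPow μ n).prod (convPow μ m)) ≤ Q) :
    IsAlmostAdditive (fun n m (g : ℕ → Γ) => φ (walk (fun i => g (n + i)) m))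
      (incrementLaw μ) Q := by
  have hφ : Measurable φ := measurable_of_countable φ
  have hpair : ∀ n m, Measurable fun g : ℕ → Γ => (walk g n, walk (fun i => g (n + i)) m) :=
    fun n m => (measurable_walk n).prodMk (measurable_walk_shift n m)
  have e : ∀ n m (g : ℕ → Γ), (φ (walk (fun i => g (0 + i)) (n + m)) -
      φ (walk (fun i => g (0 + i)) n) - φ (walk (fun i => g (n + i)) m)) ^ 4 =
      (fun x : Γ × Γ => (φ (x.1 * x.2) - φ x.1 - φ x.2) ^ 4)
        (walk g n, walk (fun i => g (n + i)) m) := fun n m g => by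
    simp only [zero_add, walk_add]
  have eone : ∀ g : ℕ → Γ, φ (walk (fun i => g (0 + i)) 1) ^ 4 =
      (fun x => φ x ^ 4) (walk g 1) := fun g => by simp only [zero_add]
  constructor
  · ext g
    exact h1
  · intro n m
    refine ⟨(hφ.comp (measurable_walk_shift n m)).aemeasurable,
      (hφ.comp (measurable_walk_shift 0 m)).aemeasurable, ?_⟩
    change Measure.map (φ ∘ fun g : ℕ → Γ => walk (fun i => g (n + i)) m) _ =
      Measure.map (φ ∘ fun g : ℕ → Γ => walk (fun i => g (0 + i)) m) _
    rw [← Measure.map_map hφ (measurable_walk_shift n m),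
      ← Measure.map_map hφ (measurable_walk_shift 0 m), map_walk_shift, map_walk_shift]
  · intro n m
    have := (indepFun_walk μ n m).comp hφ hφ
    simp only [zero_add]
    exact this
  · exact fun n m => hφ.comp (measurable_walk_shift n m)
  · simp_rw [eone]
    have h : Integrable (fun x => φ x ^ 4)
        ((incrementLaw μ).map fun g : ℕ → Γ => walk g 1) := by
      rwa [map_walk, convPow_one]
    exact h.comp_measurable (measurable_walk 1)
  · intro n m
    simp_rw [e]
    have h := hdefect n m
    rw [← map_walk_prod] at h
    exact h.comp_measurable (hpair n m)
  · simp_rw [eone]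
    rw [← integral_map (f := fun x => φ x ^ 4) (measurable_walk 1).aemeasurable
      (measurable_of_countable _).aestronglyMeasurable, map_walk, convPow_one]
    exact hle
  · intro n m
    simp_rw [e]
    rw [← integral_map (f := fun x : Γ × Γ => (φ (x.1 * x.2) - φ x.1 - φ x.2) ^ 4)
      (hpair n m).aemeasurable (measurable_of_countable _).aestronglyMeasurable, map_walk_prod]
    exact hdefect_le n m

end Walk

/-- A function on `Γ` whose defect of additivity is dominated by exponentials of Gromov products
satisfies the law of large numbers along a random walk. -/
theorem exists_ae_tendsto_walk_div {X Γ : Type*} [MetricSpace X] [Group Γ] [Countable Γ]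
    [MulAction Γ X] [IsIsometricSMul Γ X] [MeasurableSpace Γ] [MeasurableSingletonClass Γ]
    [MeasurableMul₂ Γ] (μ : Measure Γ) [IsProbabilityMeasure μ] {o : X} {ε M : ℝ} (hε : 0 < ε)
    (hμ : Integrable (fun g : Γ => Real.exp (ε * dist o (g • o))) μ)
    (hM : ∀ (n : ℕ) (z : X),
      ∫ g, Real.exp (ε * gromovProduct o z (g • o)) ∂(convPow μ n) ≤ M)
    {φ : Γ → ℝ} {K : ℝ} (h1 : φ 1 = 0)
    (hφ : ∀ g, |φ g| ≤ K * Real.exp (ε / 4 * dist o (g • o)))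
    (hdefect : ∀ g h, |φ (g * h) - φ g - φ h| ≤
      K * Real.exp (ε / 4 * gromovProduct o (g⁻¹ • o) (h • o))) :
    ∃ L : ℝ, ∀ᵐ g ∂(incrementLaw μ),
      Tendsto (fun n : ℕ => φ (walk g n) / (n : ℝ)) atTop (𝓝 L) := by
  -- Fourth powers turn the rate `ε / 4` into the rate `ε` at which moments are bounded.
  have pow4 : ∀ a u : ℝ, |a| ≤ K * Real.exp (ε / 4 * u) → a ^ 4 ≤ K ^ 4 * Real.exp (ε * u) := by
    intro a u ha
    have h2 := pow_le_pow_left₀ (abs_nonneg a) ha 4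
    rw [← abs_pow, abs_of_nonneg (by positivity), mul_pow, ← Real.exp_nat_mul] at h2
    refine h2.trans_eq ?_
    congr 2
    push_cast
    ring
  have hi1 : Integrable (fun g => φ g ^ 4) μ :=
    integrable_of_abs_le_exp hμ (K ^ 4) fun g => by
      rw [abs_of_nonneg (by positivity)]
      exact pow4 _ _ (hφ g)
  have hconv := fun n => (integrable_exp_convPow hε.le hμ n).1
  have hbd : ∀ a b : Γ, (φ (a * b) - φ a - φ b) ^ 4 ≤
      K ^ 4 * Real.exp (ε * gromovProduct o (a⁻¹ • o) (b • o)) := fun a b =>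
    pow4 _ _ (hdefect a b)
  have hi2 : ∀ n m, Integrable (fun x : Γ × Γ => (φ (x.1 * x.2) - φ x.1 - φ x.2) ^ 4)
      ((convPow μ n).prod (convPow μ m)) := by
    intro n m
    have h3 := (integrable_const (μ := convPow μ n) (K ^ 4)).mul_prod (hconv m)
    refine h3.mono' (measurable_of_countable _).aestronglyMeasurable
      (Eventually.of_forall fun x => ?_)
    rw [Real.norm_of_nonneg (by positivity)]
    refine (hbd x.1 x.2).trans ?_
    gcongr
    exact gromovProduct_le_right _ _ _
  have hle2 : ∀ n m, ∫ x : Γ × Γ, (φ (x.1 * x.2) - φ x.1 - φ x.2) ^ 4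
      ∂((convPow μ n).prod (convPow μ m)) ≤ K ^ 4 * M := by
    intro n m
    rw [integral_prod _ (hi2 n m)]
    -- With the first block frozen at `a`, the point `a⁻¹ • o` is deterministic, so the bound
    -- uniform in `z` applies to the independent second block.
    have h4 : ∀ a, ∫ b, (φ (a * b) - φ a - φ b) ^ 4 ∂(convPow μ m) ≤ K ^ 4 * M := by
      intro a
      refine (integral_mono_of_nonneg (Eventually.of_forall fun b => by positivity)
        ((integrable_exp_gromovProduct hε.le (hconv m) (a⁻¹ • o)).const_mul (K ^ 4))
        (Eventually.of_forall fun b => hbd a b)).trans ?_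
      rw [integral_const_mul]
      gcongr
      exact hM m _
    refine (integral_mono_of_nonneg (Eventually.of_forall fun a =>
      integral_nonneg fun b => by positivity) (integrable_const (K ^ 4 * M))
      (Eventually.of_forall h4)).trans_eq ?_
    simp
  have := isAlmostAdditive_walk μ (Q := max (∫ g, φ g ^ 4 ∂μ) (K ^ 4 * M)) h1 hi1
    (le_max_left _ _) hi2 fun n m => (hle2 n m).trans (le_max_right _ _)
  simpa only [zero_add] using this.exists_ae_tendsto_div

theorem mainTheorem7 {X Γ : Type*} [MetricSpace X] [ProperSpace X]
    (hX : IsCATNegOne X) (hcomplete : IsGeodesicallyComplete X)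
    [Group Γ] [Countable Γ] [MulAction Γ X] [IsIsometricSMul Γ X]
    (hΓ : IsNonelementaryAction Γ X)
    (F : UnitTangent X → ℝ) (hF : IsPotential Γ F) (hHC : HasHolderControl F)
    [MeasurableSpace Γ] [MeasurableSingletonClass Γ]
    (μ : Measure Γ) [IsProbabilityMeasure μ] (hgen : IsGenerating μ)
    (o : X) (hmom : HasExponentialMoment μ o) :
    ∃ L : ℝ, ∀ᵐ g ∂(incrementLaw μ),
      Tendsto (fun n : ℕ => fakeDist F o (walk g n • o) / (n : ℝ)) atTop (𝓝 L) := by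
  have : MeasurableMul₂ Γ := ⟨measurable_of_countable _⟩
  obtain ⟨ε, hε, hμ, M, hM⟩ :=
    hΓ.exists_integral_exp_gromovProduct_le hX.isGromovHyperbolic hgen hmom
  -- Any line will do: its tangent vector serves as the reference at which `F` is evaluated.
  obtain ⟨-, -, ℓ, -⟩ := hΓ
  obtain ⟨K₁, hK₁, hgrowth⟩ :=
    hHC.exists_abs_fakeDist_le hX hcomplete hF ℓ o (show 0 < ε / 4 by positivity)
  obtain ⟨K₂, hK₂, hdefect⟩ :=
    hHC.exists_abs_defect_le hX hcomplete hF ℓ o (show 0 < ε / 4 by positivity)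
  refine exists_ae_tendsto_walk_div μ hε hμ hM (φ := fun g => fakeDist F o (g • o))
    (K := K₁ + K₂) ?_ (fun g => ?_) fun g h => ?_
  · rw [one_smul, fakeDist_self]
  · refine (hgrowth (g • o)).trans ?_
    gcongr
    linarith
  -- The defect at `g • o` is translated by `g⁻¹`, which separates the past `g⁻¹ • o` from the
  -- future `h • o`.
  · have h1 := hdefect g o ((g * h) • o)
    have h2 : fakeDist F (g • o) ((g * h) • o) = fakeDist F o (h • o) := by
      rw [mul_smul, fakeDist_smul hX hcomplete hF]
    have h3 : gromovProduct (g • o) o ((g * h) • o) = gromovProduct o (g⁻¹ • o) (h • o) := by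
      rw [← gromovProduct_smul g o, smul_inv_smul, mul_smul]
    rw [h2, h3] at h1
    refine h1.trans ?_
    gcongr
    linarith
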